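/- All groups are finite. The power graph $\mathcal P(G)$ of a group $G$ has vertex set $G$, and distinct $x,y$ are joined if one of them is a power of the other (with positive exponent); the directed power graph $\vec{\mathcal P}(G)$ has an arc $(x,y)$ whenever $x\ne y$ and $y$ is a power of $x$. Write $x\diamond y$ if $\langle x\rangle=\langle y\rangle$. For a finite graph $\Gamma=(V,E)$ let $N[x]=\{x\}\cup\{y:\{x,y\}\in E\}$, let $N[X]=\bigcap_{x\in X}N[x]$ for $X\subseteq V$ (with $N[\varnothing]=V$), let $\hat X=N[N[X]]$, and let $\mathcal S=\{x: N[x]=V\}$ be the set of star vertices. An $\mathtt N$-class is a class of the equivalence relation $N[x]=N[y]$, and $[x]_{\mathtt N}$ is the class of $x$. Two sets of vertices are joined if some edge runs between them. **Theorem.** Let $\Gamma=(V,E)$ be the power graph of some finite group and let $n=|V|$. "$\mathcal P(G)=\Gamma$" below is understood up to graph isomorphism. Then one of the following holds. **(A)** $n\le 2$ or $|\mathcal S|>1$. Then there is, up to isomorphism, exactly one group $G$ with $\mathcal P(G)=\Gamma$, and it is found as follows. At least one of $|\mathcal S|=n$, $|\mathcal S|=1+\varphi(n)$, $|\mathcal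 S|=2$ holds. If $|\mathcal S|=n$, then $G\cong C_n$ and $n$ is a power $p^k$ $(k\ge 0)$ of a prime. If $|\mathcal S|=1+\varphi(n)\ne n$, then $G\cong C_n$ and $n$ is not such a power. If $|\mathcal S|=2$ and $n\geq 3$, then $n=4\cdot 2^k$ with $k\ge1$ and $G$ is the generalized quaternion group of order $n$. **(B)** $n\ge 3$ and $|\mathcal S|=1$, say $\mathcal S=\{1\}$. Call an $\mathtt N$-class $C$ *critical* if $\hat C$ is the disjoint union of $C$ and $\{1\}$ and $|\hat C|=p^r$ for a prime $p$ and an integer $r\ge2$. Say that $C\neq\mathcal S$ *has parameters* $(p,r,s)$ if $p$ is prime, $r\ge2$, $0\le s\le r-2$, $|C|=p^r-p^s$ and $|\hat C|=p^r$. Say that $C\ne\mathcal S$ *passes the compound test* if - $C$ is critical and there is no $x\in V\setminus\hat C$ joined to an element of $C$ with $|[x]_{\mathtt N}|\le|C|$; or - $C$ is not critical and has some parameters $(p,r,s)$. Then: 1. For every group $G$ with $\mathcal P(G)=\Gamma$ and every $\mathtt N$-class $C\neq\mathcal S$: $C$ passes the compound test if and only if it is of compound type (a union of at least two $\diamond$-classes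 of $G$), and fails it if and only if it is of plain type (a single $\diamond$-class of $G$). 2. The classes $C\ne\mathcal S$ passing the test, with parameters $(p,r,s)$, can be split into pairwise disjoint subsets $X_i(C)$, $s+1\le i\le r$, with union $C$ and $|X_i(C)|=\varphi(p^i)$. 3. Choose any splitting as in 2. Call *blocks* the sets $X_i(C)$ and the $\mathtt N$-classes $C\neq\mathcal S$ failing the test. Define a digraph $\vec\Gamma$ on $V$ in which $(x,y)$ is an arc if and only if $\{x,y\}\in E$ and one of the following holds: $y=1$; or $x\in X$, $y\in Y$ for blocks $X,Y$ such that $X=Y$, or $|X|>|Y|$, or $X\ne Y$, $|X|=|Y|\neq1$ and $X$ is joined to a block of size $1$. Then $\vec\Gamma$ is isomorphic to $\vec{\mathcal P}(G)$ for every group $G$ with $\mathcal P(G)=\Gamma$. -/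

import Mathlib

universe u w

namespace PowerGraphReconstruction

/-! ### Power graphs -/

/-- The directed power graph of a group: an arc from `x` to `y` when `y ≠ x` is a power of `x`
with positive exponent. -/
def directedPowerGraph (G : Type u) [Group G] : Digraph G where
  Adj x y := x ≠ y ∧ ∃ m : ℕ, 0 < m ∧ y = x ^ m

/-- The power graph of a group: distinct `x`, `y` are joined when one of them is a power of the
other with positive exponent. -/
def powerGraph (G : Type u) [Group G] : SimpleGraph G where
  Adj x y := x ≠ y ∧ ∃ m : ℕ, 0 < m ∧ (x = y ^ m ∨ y = x ^ m)
  symm := ⟨fun _ _ h => ⟨h.1.symm, h.2.imp fun _ hm => ⟨hm.1, hm.2.symm⟩⟩⟩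
  loopless := ⟨fun _ h => h.1 rfl⟩

/-- `Γ` is the power graph of some group whose underlying set is the vertex set. -/
def IsPowerGraph {V : Type u} (Γ : SimpleGraph V) : Prop :=
  ∃ _ : Group V, powerGraph V = Γ

/-- The set of generators of the cyclic group generated by `x`. -/
def diamondClass {G : Type u} [Group G] (x : G) : Set G :=
  {y | Subgroup.zpowers y = Subgroup.zpowers x}

/-- A set of group elements is of plain type if it is a single class of generators. -/
def IsPlain {G : Type u} [Group G] (C : Set G) : Prop :=
  ∃ x, C = diamondClass x

/-- A set of group elements is of compound type if it is a union of at least two classes of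
generators. -/
def IsCompound {G : Type u} [Group G] (C : Set G) : Prop :=
  ∃ 𝒟 : Set (Set G), 𝒟.Nontrivial ∧ (∀ D ∈ 𝒟, ∃ x, D = diamondClass x) ∧ C = ⋃₀ 𝒟

/-- `H` is, up to isomorphism, the only group having the graph `Γ` as its power graph. -/
def DeterminesGroup {V : Type u} (Γ : SimpleGraph V) (H : Type) [Group H] : Prop :=
  Nonempty (powerGraph H ≃g Γ) ∧
    ∀ (G : Type w) [Group G], Nonempty (powerGraph G ≃g Γ) → Nonempty (G ≃* H)

/-! ### Graph-theoretic notions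

From here on only the graph `Γ` enters, never a group. -/

variable {V : Type u}

/-- The closed neighbourhood `N[x]` of a vertex. -/
def closedNbhd (Γ : SimpleGraph V) (x : V) : Set V :=
  {y | Γ.Adj x y ∨ y = x}

/-- The common closed neighbourhood `N[X] = ⋂ x ∈ X, N[x]` of a set of vertices; `N[∅] = V`. -/
def commonNbhd (Γ : SimpleGraph V) (X : Set V) : Set V :=
  {y | ∀ x ∈ X, y ∈ closedNbhd Γ x}

/-- The neighbourhood closure `N[N[X]]` of a set of vertices. -/
def nbhdClosure (Γ : SimpleGraph V) (X : Set V) : Set V :=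
  commonNbhd Γ (commonNbhd Γ X)

/-- The set of star vertices, those joined to every other vertex. -/
def starSet (Γ : SimpleGraph V) : Set V :=
  {x | closedNbhd Γ x = Set.univ}

/-- The class of a vertex under the closed twin relation `N[x] = N[y]`. -/
def twinClass (Γ : SimpleGraph V) (x : V) : Set V :=
  {y | closedNbhd Γ y = closedNbhd Γ x}

/-- `C` is a closed twin class other than the class of star vertices. -/
def IsNonstarClass (Γ : SimpleGraph V) (C : Set V) : Prop :=
  (∃ x, C = twinClass Γ x) ∧ C ≠ starSet Γ

/-- `C` is a critical class: its neighbourhood closure is the disjoint union of `C` and the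
identity, and has `p ^ r` elements with `p` prime and `r ≥ 2`. This is used only for graphs with
exactly one star vertex; then that vertex is the identity, so that `starSet Γ` is the singleton of
the identity. -/
def IsCritical (Γ : SimpleGraph V) (C : Set V) : Prop :=
  (∃ x, C = twinClass Γ x) ∧ Disjoint C (starSet Γ) ∧ nbhdClosure Γ C = C ∪ starSet Γ ∧
    ∃ p r : ℕ, p.Prime ∧ 2 ≤ r ∧ (nbhdClosure Γ C).ncard = p ^ r

/-- `C` has parameters `(p, r, s)`: `p` is prime, `r ≥ 2`, `0 ≤ s ≤ r - 2`, `|C| = p ^ r - p ^ s`,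
and the neighbourhood closure of `C` has `p ^ r` elements. -/
def HasParameters (Γ : SimpleGraph V) (C : Set V) (p r s : ℕ) : Prop :=
  p.Prime ∧ 2 ≤ r ∧ s + 2 ≤ r ∧ C.ncard + p ^ s = p ^ r ∧ (nbhdClosure Γ C).ncard = p ^ r

/-- The test for compound type. A critical class passes it when no vertex outside its closure that
is joined to the class has a twin class of size at most `|C|`; a noncritical class passes it when
it has parameters. -/
def PassesCompoundTest (Γ : SimpleGraph V) (C : Set V) : Prop :=
  (IsCritical Γ C ∧
    ¬ ∃ x, x ∉ nbhdClosure Γ C ∧ (twinClass Γ x).ncard ≤ C.ncard ∧ ∃ y ∈ C, Γ.Adj x y) ∨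
  (¬ IsCritical Γ C ∧ ∃ p r s, HasParameters Γ C p r s)

/-- `X` splits every nonstar class `C` that passes the test for compound type, with parameters
`(p, r, s)`, into pairwise disjoint sets `X C i`, `s + 1 ≤ i ≤ r`, of sizes `φ (p ^ i)`. The
splitting is otherwise arbitrary. -/
def IsSplitting (Γ : SimpleGraph V) (X : Set V → ℕ → Set V) : Prop :=
  ∀ C, IsNonstarClass Γ C → PassesCompoundTest Γ C → ∀ p r s, HasParameters Γ C p r s →
    (∀ i ∈ Set.Icc (s + 1) r, (X C i).ncard = Nat.totient (p ^ i)) ∧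
    (Set.Icc (s + 1) r).PairwiseDisjoint (X C) ∧
    ⋃ i ∈ Set.Icc (s + 1) r, X C i = C

/-- The blocks: the nonstar classes failing the test for compound type, and the sets into which
the other nonstar classes have been split. -/
def blocks (Γ : SimpleGraph V) (X : Set V → ℕ → Set V) : Set (Set V) :=
  {B | IsNonstarClass Γ B ∧ ¬ PassesCompoundTest Γ B} ∪
  {B | ∃ C, IsNonstarClass Γ C ∧ PassesCompoundTest Γ C ∧
    ∃ p r s, HasParameters Γ C p r s ∧ ∃ i ∈ Set.Icc (s + 1) r, B = X C i}

/-- Two sets of vertices are joined when some edge runs between them. -/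
def AreJoined (Γ : SimpleGraph V) (A B : Set V) : Prop :=
  ∃ a ∈ A, ∃ b ∈ B, Γ.Adj a b

/-- The orientation of the edges of `Γ` given by a splitting. An edge `{x, y}` yields the arc
`(x, y)` when `y` is the star vertex, when `x` and `y` lie in the same block, when the block of `x`
is larger than that of `y`, or when the blocks are different, have the same size `≠ 1`, and the
block of `x` is joined to a block with one element. -/
def reconstruction (Γ : SimpleGraph V) (X : Set V → ℕ → Set V) : Digraph V where
  Adj x y := Γ.Adj x y ∧
    (y ∈ starSet Γ ∨
    ∃ A ∈ blocks Γ X, ∃ B ∈ blocks Γ X, x ∈ A ∧ y ∈ B ∧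
      (A = B ∨ B.ncard < A.ncard ∨
        (A ≠ B ∧ A.ncard = B.ncard ∧ A.ncard ≠ 1 ∧
          ∃ Z ∈ blocks Γ X, Z.ncard = 1 ∧ AreJoined Γ Z A)))

end PowerGraphReconstruction

open PowerGraphReconstruction

namespace PowerGraphReconstruction

/-! ### Cyclic subgroups of finite groups -/

section Cyclic

variable {G : Type u} [Group G]

open Subgroup

/-! Vertices are equal or adjacent exactly when one of the cyclic groups they generate contains the
other, so everything reduces to divisibility of orders inside cyclic groups.

Case (B) rests on the shape of a nonstar twin class `C` that contains generators of more than one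
cyclic group (`exists_eq_zpowers_diff_zpowers`). Its elements are pairwise comparable; an element
`l` of least order lies strictly between `1` and an element `t` of greatest order, and is comparable
with every power of `t`. A proper nontrivial divisor comparable with all divisors exists only for
prime powers, so `t` has order `p ^ r`, and `C = ⟨t⟩ \ ⟨b⟩` with `b` of order `p ^ s`, `s + 2 ≤ r`,
and closure `⟨t⟩`. A plain class with the same numerical parameters must be critical and generated
by an element whose order is not a prime power (`HasParameters.of_diamondClass`). The two kinds of
critical class are told apart by neighbours outside the closure: over a compound class they have
larger twin classes, while a plain class has an element of prime order below it whose class is no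
larger.

Sorting each compound class by element order is one valid splitting, and its blocks are the classes
of generators. If `y` is a power of `x`, the totient of `|y|` divides that of `|x|`, so block sizes
orient the edges except when `|x| = 2|y|` with `|y|` odd; there an involution is joined to the block
of `x` but not to that of `y` (`reconstruction_primePowerPart_adj`). Any other splitting differs by
a permutation inside twin classes, which is an automorphism of the graph
(`IsSplitting.nonempty_reconstruction_iso`).

In case (A), for more than two vertices, a nontrivial star vertex makes the group cyclic or a
`p`-group with a single subgroup of order `p` (`isCyclic_or_of_mem_starSet`). The latter is cyclic
or generalized quaternion: a self-centralizing normal subgroup is cyclic, and congruences for the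
action of an outside element on it leave only the quaternion relations
(`isCyclic_or_exists_quaternion_structure`). Counting star vertices then separates the
possibilities. -/

theorem orderOf_eq_of_zpowers_eq {x y : G} (h : zpowers y = zpowers x) :
    orderOf y = orderOf x := by
  rw [← Nat.card_zpowers, ← Nat.card_zpowers, h]

theorem zpowers_eq_iff {x y : G} : zpowers y = zpowers x ↔ y ∈ zpowers x ∧ x ∈ zpowers y :=
  ⟨fun h => ⟨h ▸ mem_zpowers y, h ▸ mem_zpowers x⟩,
    fun h => le_antisymm (zpowers_le.2 h.1) (zpowers_le.2 h.2)⟩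

theorem ncard_zpowers (x : G) : (zpowers x : Set G).ncard = orderOf x := by
  rw [← Nat.card_coe_set_eq]; exact Nat.card_zpowers x

theorem mem_diamondClass_self (x : G) : x ∈ diamondClass x := rfl

variable [Finite G]

/-- Subgroups of a finite cyclic group are ordered by divisibility of their orders. With `y = x ^
i`, `z = x ^ j` and `n` the order of `x`, the subgroup `⟨z⟩` contains `x ^ gcd(n, j)` by Bézout, and
`gcd(n, j)` divides `i`. -/
theorem mem_zpowers_of_orderOf_dvd {x y z : G} (hy : y ∈ zpowers x) (hz : z ∈ zpowers x)
    (h : orderOf y ∣ orderOf z) : y ∈ zpowers z := by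
  obtain ⟨i, rfl⟩ := mem_powers_iff_mem_zpowers.2 hy
  obtain ⟨j, rfl⟩ := mem_powers_iff_mem_zpowers.2 hz
  simp only at h ⊢
  have hn : 0 < orderOf x := orderOf_pos x
  have hg : x ^ (orderOf x).gcd j ∈ zpowers (x ^ j) := by
    refine ⟨(orderOf x).gcdB j, ?_⟩
    have := Nat.gcd_eq_gcd_ab (orderOf x) j
    simp only
    rw [← zpow_natCast x ((orderOf x).gcd j), this, zpow_add, zpow_mul, zpow_mul, zpow_natCast,
      zpow_natCast, pow_orderOf_eq_one, one_zpow, one_mul]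
  have hd : (orderOf x).gcd j ∣ i := by
    rw [orderOf_pow, orderOf_pow] at h
    refine dvd_trans ?_ (Nat.gcd_dvd_right (orderOf x) i)
    obtain ⟨c, hc⟩ := h
    have h1 := Nat.div_mul_cancel (Nat.gcd_dvd_left (orderOf x) i)
    have h2 := Nat.div_mul_cancel (Nat.gcd_dvd_left (orderOf x) j)
    have h3 : 0 < orderOf x / (orderOf x).gcd i :=
      Nat.div_pos (Nat.gcd_le_left _ hn) (Nat.gcd_pos_of_pos_left _ hn)
    refine ⟨c, Nat.eq_of_mul_eq_mul_left h3 ?_⟩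
    rw [h1, mul_comm _ c, ← mul_assoc, ← hc, h2]
  obtain ⟨c, rfl⟩ := hd
  rw [pow_mul]
  exact pow_mem hg c

theorem mem_zpowers_iff_orderOf_dvd {x y z : G} (hy : y ∈ zpowers x) (hz : z ∈ zpowers x) :
    y ∈ zpowers z ↔ orderOf y ∣ orderOf z :=
  ⟨orderOf_dvd_of_mem_zpowers, mem_zpowers_of_orderOf_dvd hy hz⟩

theorem exists_mem_zpowers_orderOf_eq (x : G) {d : ℕ} (hd : d ∣ orderOf x) :
    ∃ y ∈ zpowers x, orderOf y = d :=
  ⟨_, pow_mem (mem_zpowers x) _, orderOf_pow_orderOf_div (orderOf_pos x).ne' hd⟩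

theorem zpowers_eq_of_mem_of_orderOf_le {x y : G} (h : y ∈ zpowers x)
    (ho : orderOf x ≤ orderOf y) : zpowers y = zpowers x := by
  refine Subgroup.eq_of_le_of_card_ge (zpowers_le.2 h) ?_
  rwa [Nat.card_zpowers, Nat.card_zpowers]

theorem ncard_orderOf_eq (x : G) {d : ℕ} (hd : d ∣ orderOf x) :
    {y | y ∈ zpowers x ∧ orderOf y = d}.ncard = d.totient := by
  classical
  have := Fintype.ofFinite (zpowers x)
  have h := IsCyclic.card_orderOf_eq_totient (α := zpowers x) (d := d)
    (by rwa [← Nat.card_eq_fintype_card, Nat.card_zpowers])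
  rw [← h, ← Set.ncard_coe_finset, ← Set.ncard_image_of_injective _ Subtype.val_injective]
  congr 1
  ext y
  simp only [Set.mem_ofPred_eq, Finset.coe_filter, Finset.mem_univ, true_and, Set.mem_image,
    Subtype.exists, Subgroup.orderOf_mk, exists_and_left, exists_prop, exists_eq_right_right]
  tauto

theorem diamondClass_eq_orderOf (x : G) :
    diamondClass x = {y | y ∈ zpowers x ∧ orderOf y = orderOf x} := by
  ext y
  exact ⟨fun h => ⟨h ▸ mem_zpowers y, orderOf_eq_of_zpowers_eq h⟩,
    fun h => zpowers_eq_of_mem_of_orderOf_le h.1 h.2.ge⟩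

theorem ncard_diamondClass (x : G) : (diamondClass x).ncard = (orderOf x).totient := by
  rw [diamondClass_eq_orderOf, ncard_orderOf_eq x dvd_rfl]

theorem mem_or_mem_of_orderOf_prime_pow {p b : ℕ} (hp : p.Prime) {x y z : G}
    (hx : orderOf x = p ^ b) (hy : y ∈ zpowers x) (hz : z ∈ zpowers x) :
    y ∈ zpowers z ∨ z ∈ zpowers y := by
  rw [mem_zpowers_iff_orderOf_dvd hy hz, mem_zpowers_iff_orderOf_dvd hz hy]
  obtain ⟨i, -, hi⟩ := (Nat.dvd_prime_pow hp).1 (hx ▸ orderOf_dvd_of_mem_zpowers hy)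
  obtain ⟨j, -, hj⟩ := (Nat.dvd_prime_pow hp).1 (hx ▸ orderOf_dvd_of_mem_zpowers hz)
  rw [hi, hj]
  exact (le_total i j).imp (pow_dvd_pow p) (pow_dvd_pow p)

end Cyclic

/-! ### Arithmetic -/

/-- For a prime `q` dividing `m / d`, the full `q`-part of `m` cannot divide `d`, so `d` divides it
and is a power of `q`. Any prime divisor of `m` is comparable with this power, hence equals `q`. -/
theorem exists_prime_pow_of_dvd_comparable {m d : ℕ} (hm : m ≠ 0) (hdm : d ∣ m) (hd1 : d ≠ 1)
    (hne : d ≠ m) (h : ∀ e, e ∣ m → e ∣ d ∨ d ∣ e) : ∃ p b : ℕ, p.Prime ∧ m = p ^ b := by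
  obtain ⟨c, rfl⟩ := hdm
  have hc : c ≠ 1 := by rintro rfl; simp at hne
  obtain ⟨q, hq, hqc⟩ := Nat.exists_prime_and_dvd hc
  have hd0 : d ≠ 0 := left_ne_zero_of_mul hm
  have h1 : d ∣ q ^ (d * c).factorization q := by
    refine (h _ (Nat.ordProj_dvd _ q)).resolve_left fun h2 => ?_
    have h3 : q ^ (d.factorization q + 1) ∣ d * c := by
      rw [pow_succ]; exact mul_dvd_mul (Nat.ordProj_dvd d q) hqc
    have h4 := (hq.pow_dvd_iff_le_factorization hm).1 h3
    have h5 := (hq.pow_dvd_iff_le_factorization hd0).1 h2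
    omega
  obtain ⟨a, -, rfl⟩ := (Nat.dvd_prime_pow hq).1 h1
  refine ⟨q, _, hq, Nat.eq_prime_pow_of_unique_prime_dvd hm fun {r} hr hrm => ?_⟩
  have ha : a ≠ 0 := by rintro rfl; simp at hd1
  rcases h r hrm with h2 | h2
  · exact (Nat.prime_dvd_prime_iff_eq hr hq).1 (hr.dvd_of_dvd_pow h2)
  · exact ((Nat.prime_dvd_prime_iff_eq hq hr).1 ((dvd_pow_self q ha).trans h2)).symm

theorem prime_pow_inj {p q r t : ℕ} (hp : p.Prime) (hq : q.Prime) (hr : r ≠ 0)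
    (h : p ^ r = q ^ t) : p = q ∧ r = t := by
  have h1 : p ∣ q := hp.dvd_of_dvd_pow (h ▸ dvd_pow_self p hr)
  obtain rfl := (Nat.prime_dvd_prime_iff_eq hp hq).1 h1
  exact ⟨rfl, Nat.pow_right_injective hp.two_le h⟩

/-! ### Closed neighbourhoods -/

section Graph

variable {V : Type u} {Γ : SimpleGraph V}

theorem mem_closedNbhd_comm {x y : V} : x ∈ closedNbhd Γ y ↔ y ∈ closedNbhd Γ x := by
  simp only [closedNbhd, Set.mem_ofPred_eq, Γ.adj_comm, eq_comm]

theorem mem_twinClass_self (x : V) : x ∈ twinClass Γ x := rfl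

theorem twinClass_eq_of_mem {x y : V} (h : y ∈ twinClass Γ x) : twinClass Γ y = twinClass Γ x := by
  have h' : closedNbhd Γ y = closedNbhd Γ x := h
  simp only [twinClass, h']

theorem commonNbhd_twinClass (x : V) : commonNbhd Γ (twinClass Γ x) = closedNbhd Γ x := by
  ext y
  refine ⟨fun h => h x rfl, fun h z hz => ?_⟩
  rw [show closedNbhd Γ z = closedNbhd Γ x from hz]
  exact h

theorem nbhdClosure_twinClass (x : V) :
    nbhdClosure Γ (twinClass Γ x) = {z | closedNbhd Γ x ⊆ closedNbhd Γ z} := by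
  ext z
  rw [nbhdClosure, commonNbhd_twinClass]
  exact ⟨fun h w hw => mem_closedNbhd_comm.1 (h w hw), fun h w hw => mem_closedNbhd_comm.1 (h hw)⟩

theorem twinClass_subset_nbhdClosure (x : V) :
    twinClass Γ x ⊆ nbhdClosure Γ (twinClass Γ x) := by
  rw [nbhdClosure_twinClass]
  exact fun y hy => (show closedNbhd Γ y = closedNbhd Γ x from hy).ge

theorem mem_starSet_of_twin {x y : V} (h : closedNbhd Γ y = closedNbhd Γ x) :
    y ∈ starSet Γ ↔ x ∈ starSet Γ := by
  simp only [starSet, Set.mem_ofPred_eq, h]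

theorem twinClass_of_mem_starSet {x : V} (h : x ∈ starSet Γ) : twinClass Γ x = starSet Γ := by
  simp only [twinClass, starSet, show closedNbhd Γ x = Set.univ from h]

theorem isNonstarClass_iff {C : Set V} :
    IsNonstarClass Γ C ↔ ∃ x, x ∉ starSet Γ ∧ C = twinClass Γ x := by
  constructor
  · rintro ⟨⟨x, rfl⟩, h⟩
    exact ⟨x, fun hx => h (twinClass_of_mem_starSet hx), rfl⟩
  · rintro ⟨x, hx, rfl⟩
    exact ⟨⟨x, rfl⟩, fun h => hx (h ▸ mem_twinClass_self x)⟩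

theorem disjoint_twinClass_starSet {x : V} (h : x ∉ starSet Γ) :
    Disjoint (twinClass Γ x) (starSet Γ) :=
  Set.disjoint_left.2 fun _ hy hyS => h ((mem_starSet_of_twin hy).1 hyS)

/-- The size of the closure fixes `p` and `r`; the difference from `|C|` then fixes `s`. -/
theorem HasParameters.unique {C : Set V} {p r s p' r' s' : ℕ} (h : HasParameters Γ C p r s)
    (h' : HasParameters Γ C p' r' s') : p = p' ∧ r = r' ∧ s = s' := by
  obtain ⟨hp, hr, hs, hc, hn⟩ := h
  obtain ⟨hp', hr', hs', hc', hn'⟩ := h'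
  obtain ⟨rfl, rfl⟩ := prime_pow_inj hp hp' (by omega) (hn.symm.trans hn')
  refine ⟨rfl, rfl, Nat.pow_right_injective hp.two_le ?_⟩
  simp only
  omega

end Graph

/-! ### Twin classes of power graphs -/

section PowerGraph

variable {G : Type u} [Group G] [Finite G]

open Subgroup

theorem mem_zpowers_iff_exists_pos_pow {x y : G} :
    y ∈ zpowers x ↔ ∃ m : ℕ, 0 < m ∧ y = x ^ m := by
  constructor
  · intro h
    obtain ⟨m, rfl⟩ := mem_powers_iff_mem_zpowers.2 h
    -- Adding the order keeps the power and makes the exponent positive.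
    refine ⟨m + orderOf x, by have := orderOf_pos x; omega, ?_⟩
    simp [pow_add, pow_orderOf_eq_one]
  · rintro ⟨m, -, rfl⟩
    exact pow_mem (mem_zpowers x) m

theorem powerGraph_adj {x y : G} :
    (powerGraph G).Adj x y ↔ x ≠ y ∧ (x ∈ zpowers y ∨ y ∈ zpowers x) := by
  rw [mem_zpowers_iff_exists_pos_pow, mem_zpowers_iff_exists_pos_pow, ← exists_or]
  simp only [← and_or_left]
  rfl

theorem directedPowerGraph_adj {x y : G} :
    (directedPowerGraph G).Adj x y ↔ x ≠ y ∧ y ∈ zpowers x := by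
  rw [mem_zpowers_iff_exists_pos_pow]
  rfl

theorem mem_closedNbhd_powerGraph {x y : G} :
    y ∈ closedNbhd (powerGraph G) x ↔ y ∈ zpowers x ∨ x ∈ zpowers y := by
  simp only [closedNbhd, Set.mem_ofPred_eq, powerGraph_adj]
  by_cases h : y = x
  · subst h; simp
  · simp only [h, or_false, ne_eq, Ne.symm h, not_false_eq_true, true_and]
    exact or_comm

theorem mem_starSet_powerGraph {x : G} :
    x ∈ starSet (powerGraph G) ↔ ∀ y, y ∈ zpowers x ∨ x ∈ zpowers y := by
  simp only [starSet, Set.mem_ofPred_eq, Set.eq_univ_iff_forall, mem_closedNbhd_powerGraph]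

theorem one_mem_starSet : (1 : G) ∈ starSet (powerGraph G) :=
  mem_starSet_powerGraph.2 fun _ => Or.inr (one_mem _)

theorem closedNbhd_eq_of_zpowers_eq {x y : G} (h : zpowers y = zpowers x) :
    closedNbhd (powerGraph G) y = closedNbhd (powerGraph G) x := by
  ext z
  rw [mem_closedNbhd_powerGraph, mem_closedNbhd_powerGraph, h, ← zpowers_le (g := y), h, zpowers_le]

theorem diamondClass_subset_twinClass (x : G) :
    diamondClass x ⊆ twinClass (powerGraph G) x :=
  fun _ hy => closedNbhd_eq_of_zpowers_eq hy

/-- The subgroups of `⟨z⟩` form a chain, so whatever lies below `z` is comparable with `y`; whatever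
lies above `z` lies above `y`. -/
theorem closedNbhd_subset_of_orderOf_prime_pow {p c : ℕ} (hp : p.Prime) {y z : G}
    (hz : orderOf z = p ^ c) (hy : y ∈ zpowers z) :
    closedNbhd (powerGraph G) z ⊆ closedNbhd (powerGraph G) y := by
  intro w hw
  rw [mem_closedNbhd_powerGraph] at hw ⊢
  rcases hw with hw | hw
  · exact mem_or_mem_of_orderOf_prime_pow hp hz hw hy
  · exact Or.inr (zpowers_le.2 hw hy)

/-- If all elements of `⟨y⟩` are comparable with some element strictly between `1` and `y`, then
the order of `y` is a prime power. -/
theorem exists_orderOf_eq_prime_pow {x y : G} (hx : x ≠ 1) (hxy : x ∈ zpowers y)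
    (hyx : y ∉ zpowers x) (h : ∀ w ∈ zpowers y, w ∈ closedNbhd (powerGraph G) x) :
    ∃ p b : ℕ, p.Prime ∧ orderOf y = p ^ b := by
  refine exists_prime_pow_of_dvd_comparable (orderOf_pos y).ne' (orderOf_dvd_of_mem_zpowers hxy)
    (by rwa [ne_eq, orderOf_eq_one_iff]) (fun he => hyx ?_) fun e he => ?_
  · exact (zpowers_eq_iff.1 (zpowers_eq_of_mem_of_orderOf_le hxy he.ge)).2
  · obtain ⟨w, hw, rfl⟩ := exists_mem_zpowers_orderOf_eq y he
    exact (mem_closedNbhd_powerGraph.1 (h w hw)).imp orderOf_dvd_of_mem_zpowers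
      orderOf_dvd_of_mem_zpowers

/-- An element of prime power order with a proper nontrivial twin power lies only in cyclic
subgroups of prime power order. -/
theorem orderOf_prime_pow_of_mem_zpowers {p b : ℕ} (hp : p.Prime) {x y z : G}
    (hy : orderOf y = p ^ b)
    (hxy : x ∈ zpowers y) (hyx : y ∉ zpowers x)
    (h : closedNbhd (powerGraph G) x = closedNbhd (powerGraph G) y) (hyz : y ∈ zpowers z) :
    ∃ c, orderOf z = p ^ c := by
  refine ⟨_, Nat.eq_prime_pow_of_unique_prime_dvd (orderOf_pos z).ne' fun {q} hq hqz => ?_⟩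
  by_contra hqp
  obtain ⟨a, -, ha⟩ := (Nat.dvd_prime_pow hp).1 (hy ▸ orderOf_dvd_of_mem_zpowers hxy)
  have hxz : x ∈ zpowers z := zpowers_le.2 hyz hxy
  have hcop : (orderOf x).Coprime q := by
    rw [ha]; exact Nat.Coprime.pow_left a ((Nat.coprime_primes hp hq).2 (Ne.symm hqp))
  -- An element `u` of order `|x| q` lies above `x` but is incomparable with `y`: `q` does not
  -- divide `|y|`, and `|y|` does not divide `|x| q`.
  obtain ⟨u, hu, hou⟩ := exists_mem_zpowers_orderOf_eq z
    (hcop.mul_dvd_of_dvd_of_dvd (orderOf_dvd_of_mem_zpowers hxz) hqz)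
  have hxu : x ∈ zpowers u := mem_zpowers_of_orderOf_dvd hxz hu (hou ▸ dvd_mul_right _ _)
  have hu' : u ∈ closedNbhd (powerGraph G) y := h ▸ mem_closedNbhd_powerGraph.2 (Or.inr hxu)
  rcases mem_closedNbhd_powerGraph.1 hu' with h1 | h1
  · have h2 : q ∣ p ^ b := by
      rw [← hy]
      exact (hou ▸ dvd_mul_left _ _ : q ∣ orderOf u).trans (orderOf_dvd_of_mem_zpowers h1)
    exact hqp ((Nat.prime_dvd_prime_iff_eq hq hp).1 (hq.dvd_of_dvd_pow h2))
  · have h2 := orderOf_dvd_of_mem_zpowers h1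
    rw [hou] at h2
    refine hyx (mem_zpowers_of_orderOf_dvd (mem_zpowers y) hxy
      (Nat.Coprime.dvd_of_dvd_mul_right ?_ h2))
    rw [hy]; exact Nat.Coprime.pow_left b ((Nat.coprime_primes hp hq).2 (Ne.symm hqp))

/-- The structure of the twin classes that are not single classes of generators. -/
theorem exists_eq_zpowers_diff_zpowers {x y : G} (hx : x ∉ starSet (powerGraph G))
    (hy : y ∈ twinClass (powerGraph G) x) (hne : zpowers y ≠ zpowers x) :
    ∃ (p r s : ℕ) (t b : G), p.Prime ∧ s + 2 ≤ r ∧ orderOf t = p ^ r ∧ b ∈ zpowers t ∧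
      orderOf b = p ^ s ∧ twinClass (powerGraph G) x = (zpowers t : Set G) \ zpowers b ∧
      nbhdClosure (powerGraph G) (twinClass (powerGraph G) x) = zpowers t ∧
      ∀ z, t ∈ zpowers z → ∃ c, orderOf z = p ^ c := by
  set C := twinClass (powerGraph G) x with hC
  have hxC : x ∈ C := mem_twinClass_self x
  obtain ⟨t, htC, ht⟩ := Set.exists_max_image C orderOf (Set.toFinite C) ⟨x, hxC⟩
  obtain ⟨l, hlC, hl⟩ := Set.exists_min_image C orderOf (Set.toFinite C) ⟨x, hxC⟩
  have hN : ∀ {a b}, a ∈ C → b ∈ C →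
      closedNbhd (powerGraph G) a = closedNbhd (powerGraph G) b := fun ha hb =>
    (show _ = closedNbhd (powerGraph G) x from ha).trans
      (show _ = closedNbhd (powerGraph G) x from hb).symm
  have hcomp : ∀ {a b}, a ∈ C → b ∈ C → a ∈ zpowers b ∨ b ∈ zpowers a := fun {a b} ha hb =>
    mem_closedNbhd_powerGraph.1 (hN ha hb ▸ (mem_closedNbhd_powerGraph.2 (Or.inl (mem_zpowers a))))
  have hCt : ∀ {a}, a ∈ C → a ∈ zpowers t := fun {a} ha => (hcomp ha htC).elim id fun h =>
    (zpowers_eq_iff.1 (zpowers_eq_of_mem_of_orderOf_le h (ht a ha))).2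
  have hlC' : ∀ {a}, a ∈ C → l ∈ zpowers a := fun {a} ha => (hcomp hlC ha).elim id fun h =>
    (zpowers_eq_iff.1 (zpowers_eq_of_mem_of_orderOf_le h (hl a ha))).2
  have hltC : t ∉ zpowers l := fun h => hne <| by
    have : ∀ {a}, a ∈ C → zpowers a = zpowers t := fun ha =>
      zpowers_eq_iff.2 ⟨hCt ha, zpowers_le.2 (hlC' ha) h⟩
    rw [this hy, this hxC]
  have hlt : l ∈ zpowers t := hlC' htC
  have hl1 : l ≠ 1 := by
    rintro rfl
    exact hx ((mem_starSet_of_twin hlC).1 one_mem_starSet)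
  obtain ⟨p, r, hp, hr⟩ := exists_orderOf_eq_prime_pow hl1 hlt hltC fun w hw =>
    hN htC hlC ▸ mem_closedNbhd_powerGraph.2 (Or.inl hw)
  have hup : ∀ z, t ∈ zpowers z → ∃ c, orderOf z = p ^ c := fun z hz =>
    orderOf_prime_pow_of_mem_zpowers hp hr hlt hltC (hN hlC htC) hz
  obtain ⟨k, hkr, hk⟩ := (Nat.dvd_prime_pow hp).1 (hr ▸ orderOf_dvd_of_mem_zpowers hlt)
  have hk0 : k ≠ 0 := by
    rintro rfl
    exact hl1 (orderOf_eq_one_iff.1 (by rw [hk, pow_zero]))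
  have hkr' : k ≠ r := by
    rintro rfl
    exact hltC (mem_zpowers_of_orderOf_dvd (mem_zpowers t) hlt (by rw [hr, hk]))
  -- The least order in the class is `p ^ (s + 1)`, so `b` of order `p ^ s` generates the largest
  -- subgroup missing the class; `s + 1 < r` because `l` and `t` generate different groups.
  obtain ⟨s, rfl⟩ := Nat.exists_eq_succ_of_ne_zero hk0
  obtain ⟨b, hbt, hb⟩ := exists_mem_zpowers_orderOf_eq t (d := p ^ s)
    (hr ▸ pow_dvd_pow p (by omega))
  -- Along the chain, `N[t] ⊆ N[z] ⊆ N[l]`, and the two ends coincide.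
  have hmem : ∀ {z}, l ∈ zpowers z → z ∈ zpowers t → z ∈ C := fun {z} h1 h2 => by
    refine Set.Subset.antisymm ?_ ?_
    · obtain ⟨c, -, hc⟩ := (Nat.dvd_prime_pow hp).1 (hr ▸ orderOf_dvd_of_mem_zpowers h2)
      exact hN hlC hxC ▸ closedNbhd_subset_of_orderOf_prime_pow hp hc h1
    · exact hN htC hxC ▸ closedNbhd_subset_of_orderOf_prime_pow hp hr h2
  refine ⟨p, r, s, t, b, hp, by omega, hr, hbt, hb, ?_, ?_, hup⟩
  · ext z
    simp only [Set.mem_sdiff, SetLike.mem_coe]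
    constructor
    · refine fun hz => ⟨hCt hz, fun hzb => ?_⟩
      have := orderOf_dvd_of_mem_zpowers (zpowers_le.2 hzb (hlC' hz))
      rw [hk, hb, Nat.pow_dvd_pow_iff_le_right hp.one_lt] at this
      omega
    · rintro ⟨hz, hzb⟩
      refine hmem ?_ hz
      rw [mem_zpowers_iff_orderOf_dvd hlt hz]
      rw [mem_zpowers_iff_orderOf_dvd hz hbt] at hzb
      obtain ⟨c, -, hc⟩ := (Nat.dvd_prime_pow hp).1 (hr ▸ orderOf_dvd_of_mem_zpowers hz)
      rw [hc, hb, Nat.pow_dvd_pow_iff_le_right hp.one_lt] at hzb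
      rw [hc, hk]
      exact pow_dvd_pow p (by omega)
  · rw [hC, nbhdClosure_twinClass]
    ext z
    simp only [Set.mem_ofPred_eq, SetLike.mem_coe, ← hN htC hxC]
    constructor
    · intro h
      rcases mem_closedNbhd_powerGraph.1 (h (mem_closedNbhd_powerGraph.2 (Or.inl (mem_zpowers t))))
        with h1 | h1
      -- An element of the closure above `t` has prime power order, so its neighbourhood is also
      -- contained in `N[t]`: it is a twin of `t`, hence in `⟨t⟩` by the choice of `t`.
      · obtain ⟨c, hc⟩ := hup z h1
        exact hCt (((closedNbhd_subset_of_orderOf_prime_pow hp hc h1).antisymm h).trans (hN htC hxC))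
      · exact h1
    · exact closedNbhd_subset_of_orderOf_prime_pow hp hr

theorem twinClass_eq_diamondClass {x : G}
    (h : ∀ y ∈ twinClass (powerGraph G) x, zpowers y = zpowers x) :
    twinClass (powerGraph G) x = diamondClass x :=
  Set.Subset.antisymm h (diamondClass_subset_twinClass x)

/-- A class of generators that is a twin class and has parameters is critical, and its elements do
not have prime power order. -/
theorem HasParameters.of_diamondClass {x : G} (hx : x ∉ starSet (powerGraph G))
    (hC : twinClass (powerGraph G) x = diamondClass x) {p r s : ℕ}
    (h : HasParameters (powerGraph G) (twinClass (powerGraph G) x) p r s) :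
    nbhdClosure (powerGraph G) (twinClass (powerGraph G) x) =
      twinClass (powerGraph G) x ∪ {1} ∧ ∀ q b : ℕ, q.Prime → orderOf x ≠ q ^ b := by
  obtain ⟨hp, hr, hs, hc, hn⟩ := h
  have hx1 : x ≠ 1 := fun h => hx (h ▸ one_mem_starSet)
  set D := nbhdClosure (powerGraph G) (twinClass (powerGraph G) x) with hD
  have hDmem : ∀ {z}, z ∈ D ↔ closedNbhd (powerGraph G) x ⊆ closedNbhd (powerGraph G) z := by
    intro z; rw [hD, nbhdClosure_twinClass]; rfl
  have hCD : twinClass (powerGraph G) x ⊆ D := twinClass_subset_nbhdClosure x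
  have hDC : (D \ twinClass (powerGraph G) x).ncard = p ^ s := by
    rw [Set.ncard_sdiff hCD (Set.toFinite _)]; omega
  have hps : 4 * p ^ s ≤ p ^ r := by
    calc 4 * p ^ s ≤ p ^ 2 * p ^ s := Nat.mul_le_mul_right _ (Nat.pow_le_pow_left hp.two_le 2)
      _ = p ^ (s + 2) := by rw [← pow_add, add_comm]
      _ ≤ p ^ r := Nat.pow_le_pow_right hp.pos hs
  have hps0 : 0 < p ^ s := pow_pos hp.pos s
  -- Otherwise `z` lies strictly above `x` and all generators of `⟨z⟩` lie in `D \ C`. This gives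
  -- `|C| = φ(|x|) ≤ φ(|z|) ≤ p ^ s`, whereas `|C| = p ^ r - p ^ s ≥ 3 p ^ s`.
  have hle : ∀ {z}, z ∈ D → z ∈ zpowers x := by
    intro z hz
    by_contra hzx
    have hxz : x ∈ zpowers z := (mem_closedNbhd_powerGraph.1 (hDmem.1 hz
      (mem_closedNbhd_powerGraph.2 (Or.inl (mem_zpowers x))))).resolve_right hzx
    have hsub : diamondClass z ⊆ D \ twinClass (powerGraph G) x := by
      intro w hw
      refine ⟨hDmem.2 (closedNbhd_eq_of_zpowers_eq hw ▸ hDmem.1 hz), fun h => hzx ?_⟩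
      rw [hC] at h
      rw [← show zpowers w = zpowers x from h, show zpowers w = zpowers z from hw]
      exact mem_zpowers z
    have h1 := Set.ncard_le_ncard hsub (Set.toFinite _)
    rw [ncard_diamondClass, hDC] at h1
    rw [hC, ncard_diamondClass] at hc
    have h2 := Nat.le_of_dvd (Nat.totient_pos.2 (orderOf_pos z))
      (Nat.totient_dvd_of_dvd (orderOf_dvd_of_mem_zpowers hxz))
    omega
  -- If the order were a prime power, the closure would be `⟨x⟩`, so the order would be `p ^ r` and
  -- `|C| = p ^ r - p ^ (r - 1)`, contradicting `s ≤ r - 2`.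
  have hnpp : ∀ q b : ℕ, q.Prime → orderOf x ≠ q ^ b := by
    intro q b hq hqb
    have hDx : D = zpowers x := Set.Subset.antisymm (fun z => hle) fun z hz =>
      hDmem.2 (closedNbhd_subset_of_orderOf_prime_pow hq hqb hz)
    rw [hDx, ncard_zpowers, hqb] at hn
    obtain ⟨rfl, rfl⟩ := prime_pow_inj hp hq (by omega) hn.symm
    rw [hC, ncard_diamondClass, hqb] at hc
    obtain ⟨k, rfl⟩ : ∃ k, r = k + 1 := ⟨r - 1, by omega⟩
    rw [Nat.totient_prime_pow_succ hp] at hc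
    have h1 : p ^ s < p ^ k := Nat.pow_lt_pow_right hp.one_lt (by omega)
    have h2 : p ^ (k + 1) = p ^ k * (p - 1) + p ^ k := by
      rw [← Nat.mul_succ, Nat.succ_eq_add_one, Nat.sub_add_cancel hp.one_lt.le, pow_succ]
    omega
  refine ⟨Set.Subset.antisymm (fun z hz => ?_) (Set.union_subset hCD ?_), hnpp⟩
  · by_contra hzC
    simp only [Set.mem_union, Set.mem_singleton_iff, not_or] at hzC
    have hzx : x ∉ zpowers z := fun h => hzC.1 (hC ▸ zpowers_eq_iff.2 ⟨hle hz, h⟩)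
    obtain ⟨q, b, hq, hqb⟩ := exists_orderOf_eq_prime_pow hzC.2 (hle hz) hzx fun w hw =>
      hDmem.1 hz (mem_closedNbhd_powerGraph.2 (Or.inl hw))
    exact hnpp q b hq hqb
  · rintro _ rfl
    rw [hDmem, show closedNbhd (powerGraph G) (1 : G) = Set.univ from one_mem_starSet]
    exact Set.subset_univ _

end PowerGraph

/-! ### The test for compound type -/

section CompoundTest

variable {G : Type u} [Group G]

open Subgroup

/-- The elements of prime power order `p ^ i` in a set, for any prime `p`. -/
def primePowerPart (C : Set G) (i : ℕ) : Set G :=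
  {z ∈ C | ∃ p : ℕ, p.Prime ∧ orderOf z = p ^ i}

theorem primePowerPart_twinClass_eq {x t b : G} {p r s i : ℕ} (hp : p.Prime)
    (ht : orderOf t = p ^ r) (hb : orderOf b = p ^ s)
    (hC : twinClass (powerGraph G) x = (zpowers t : Set G) \ zpowers b)
    (hi : i ∈ Set.Icc (s + 1) r) :
    primePowerPart (twinClass (powerGraph G) x) i = {z | z ∈ zpowers t ∧ orderOf z = p ^ i} := by
  ext z
  simp only [primePowerPart, hC, Set.mem_sdiff, SetLike.mem_coe,
    Set.mem_ofPred_eq]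
  constructor
  · rintro ⟨⟨hz, -⟩, q, hq, hqi⟩
    obtain ⟨j, -, hj⟩ := (Nat.dvd_prime_pow hp).1 (ht ▸ orderOf_dvd_of_mem_zpowers hz)
    obtain ⟨rfl, rfl⟩ := prime_pow_inj hq hp (by have := hi.1; omega) (hqi.symm.trans hj)
    exact ⟨hz, hj⟩
  · rintro ⟨hz, hzi⟩
    refine ⟨⟨hz, fun hzb => ?_⟩, p, hp, hzi⟩
    have := orderOf_dvd_of_mem_zpowers hzb
    rw [hzi, hb, Nat.pow_dvd_pow_iff_le_right hp.one_lt] at this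
    have := hi.1
    omega

variable [Finite G]

theorem exists_hasParameters_of_zpowers_ne {x y : G} (hx : x ∉ starSet (powerGraph G))
    (hy : y ∈ twinClass (powerGraph G) x) (hne : zpowers y ≠ zpowers x) :
    ∃ (p r s : ℕ) (t b : G), HasParameters (powerGraph G) (twinClass (powerGraph G) x) p r s ∧
      orderOf t = p ^ r ∧ b ∈ zpowers t ∧ orderOf b = p ^ s ∧
      twinClass (powerGraph G) x = (zpowers t : Set G) \ zpowers b := by
  obtain ⟨p, r, s, t, b, hp, hs, ht, hbt, hb, hC, hD, -⟩ := exists_eq_zpowers_diff_zpowers hx hy hne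
  refine ⟨p, r, s, t, b, ⟨hp, by omega, hs, ?_, by rw [hD, ncard_zpowers, ht]⟩, ht, hbt, hb, hC⟩
  have h := Set.ncard_sdiff_add_ncard_of_subset (s := (zpowers b : Set G)) (t := zpowers t)
    (zpowers_le.2 hbt) (Set.toFinite _)
  rwa [ncard_zpowers, ncard_zpowers, ht, hb, ← hC] at h

/-- A vertex outside the closure `⟨t⟩` and joined to the class lies strictly above `t`, so it has
order `p ^ c` with `c > r`. Its twin class has at least `φ(p ^ c) ≥ p ^ r` elements, more than `p ^
r - p ^ s`. -/
theorem passesCompoundTest_of_zpowers_ne {x y : G} (hx : x ∉ starSet (powerGraph G))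
    (hy : y ∈ twinClass (powerGraph G) x) (hne : zpowers y ≠ zpowers x) :
    PassesCompoundTest (powerGraph G) (twinClass (powerGraph G) x) := by
  by_cases hcrit : IsCritical (powerGraph G) (twinClass (powerGraph G) x)
  swap
  · obtain ⟨p, r, s, -, -, h, -⟩ := exists_hasParameters_of_zpowers_ne hx hy hne
    exact Or.inr ⟨hcrit, p, r, s, h⟩
  refine Or.inl ⟨hcrit, ?_⟩
  rintro ⟨z, hz, hle, w, hw, hadj⟩
  obtain ⟨p, r, s, t, b, hp, hs, ht, hbt, hb, hC, hD, hup⟩ :=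
    exists_eq_zpowers_diff_zpowers hx hy hne
  have htb : t ∉ zpowers b := fun h => by
    have := orderOf_dvd_of_mem_zpowers h
    rw [ht, hb, Nat.pow_dvd_pow_iff_le_right hp.one_lt] at this
    omega
  have htC : t ∈ twinClass (powerGraph G) x := hC ▸ ⟨mem_zpowers t, htb⟩
  have hwt : closedNbhd (powerGraph G) w = closedNbhd (powerGraph G) t := Eq.trans hw htC.symm
  rw [hD, SetLike.mem_coe] at hz
  have hzt : t ∈ zpowers z := by
    have h1 : z ∈ closedNbhd (powerGraph G) t := hwt ▸ Or.inl hadj.symm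
    exact (mem_closedNbhd_powerGraph.1 h1).resolve_left hz
  obtain ⟨c, hc⟩ := hup z hzt
  have hrc : r < c := by
    by_contra hcr
    refine hz (zpowers_eq_iff.1 (zpowers_eq_of_mem_of_orderOf_le hzt ?_)).2
    rw [hc, ht]
    exact Nat.pow_le_pow_right hp.pos (not_lt.1 hcr)
  obtain ⟨k, rfl⟩ : ∃ k, c = k + 1 := ⟨c - 1, by omega⟩
  have h1 := Set.ncard_le_ncard (diamondClass_subset_twinClass z) (Set.toFinite _)
  rw [ncard_diamondClass, hc, Nat.totient_prime_pow_succ hp] at h1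
  have h2 : p ^ r ≤ p ^ k := Nat.pow_le_pow_right hp.pos (by omega)
  have h3 : p ^ k ≤ p ^ k * (p - 1) := Nat.le_mul_of_pos_right _ (Nat.sub_pos_of_lt hp.one_lt)
  have h4 := Set.ncard_sdiff_add_ncard_of_subset (s := (zpowers b : Set G)) (t := zpowers t)
    (zpowers_le.2 hbt) (Set.toFinite _)
  rw [ncard_zpowers, ncard_zpowers, ht, hb, ← hC] at h4
  have h5 : 0 < p ^ s := pow_pos hp.pos s
  omega

/-- A noncritical plain class has no parameters. In a critical one the order of `x` is not a prime
power, and a power `z` of `x` of prime order witnesses failure: it lies outside the closure, and its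
class is plain of size dividing `φ(|x|)`. -/
theorem not_passesCompoundTest_of_diamondClass (hS : starSet (powerGraph G) = {1}) {x : G}
    (hx : x ∉ starSet (powerGraph G)) (hC : twinClass (powerGraph G) x = diamondClass x) :
    ¬ PassesCompoundTest (powerGraph G) (twinClass (powerGraph G) x) := by
  have hdisj := disjoint_twinClass_starSet hx
  rintro (⟨⟨-, -, hD, p, r, hp, hr, hn⟩, hno⟩ | ⟨hcrit, p, r, s, h⟩)
  -- Since the closure exceeds the class by the identity alone, `p ^ s = 1`.
  · have hpar : HasParameters (powerGraph G) (twinClass (powerGraph G) x) p r 0 := by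
      refine ⟨hp, hr, hr, ?_, hn⟩
      rw [← hn, hD, Set.ncard_union_eq hdisj (Set.toFinite _) (Set.toFinite _), hS,
        Set.ncard_singleton, pow_zero]
    obtain ⟨-, hnpp⟩ := hpar.of_diamondClass hx hC
    have hx1 : orderOf x ≠ 1 := fun h => hx (orderOf_eq_one_iff.1 h ▸ one_mem_starSet)
    obtain ⟨q, hq, hqx⟩ := Nat.exists_prime_and_dvd hx1
    obtain ⟨z, hz, hzq⟩ := exists_mem_zpowers_orderOf_eq x hqx
    have hzx : z ≠ x := by
      rintro rfl
      exact hnpp q 1 hq (by rw [hzq, pow_one])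
    have hz1 : z ≠ 1 := by
      rintro rfl
      exact hq.one_lt.ne (by rw [← hzq, orderOf_one])
    have hzS : z ∉ starSet (powerGraph G) := by rwa [hS]
    refine hno ⟨z, ?_, ?_, x, rfl, powerGraph_adj.2 ⟨hzx, Or.inl hz⟩⟩
    · rw [hD, hS, hC]
      rintro (h | h)
      · exact hnpp q 1 hq (by rw [← orderOf_eq_of_zpowers_eq h, hzq, pow_one])
      · exact hz1 h
    · by_cases hzC : ∀ y ∈ twinClass (powerGraph G) z, zpowers y = zpowers z
      · rw [twinClass_eq_diamondClass hzC, hC, ncard_diamondClass, ncard_diamondClass]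
        exact Nat.le_of_dvd (Nat.totient_pos.2 (orderOf_pos x))
          (Nat.totient_dvd_of_dvd (orderOf_dvd_of_mem_zpowers hz))
      · push Not at hzC
        obtain ⟨y, hy, hne⟩ := hzC
        obtain ⟨p', r', s', t, b, hp', hs', ht, hbt, hb, hC', -, hup⟩ :=
          exists_eq_zpowers_diff_zpowers hzS hy hne
        -- Were the class of `z` compound with top element `t`, then `x`, comparable with `t`, would
        -- have prime power order whether below or above it.
        exfalso
        have htb : t ∉ zpowers b := fun h => by
          have := orderOf_dvd_of_mem_zpowers h
          rw [ht, hb, Nat.pow_dvd_pow_iff_le_right hp'.one_lt] at this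
          omega
        have htC : t ∈ twinClass (powerGraph G) z := hC' ▸ ⟨mem_zpowers t, htb⟩
        have hxN : x ∈ closedNbhd (powerGraph G) t := by
          rw [show closedNbhd (powerGraph G) t = _ from htC]
          exact mem_closedNbhd_powerGraph.2 (Or.inr hz)
        rcases mem_closedNbhd_powerGraph.1 hxN with h | h
        · obtain ⟨i, -, hi⟩ := (Nat.dvd_prime_pow hp').1 (ht ▸ orderOf_dvd_of_mem_zpowers h)
          exact hnpp p' i hp' hi
        · obtain ⟨c, hc⟩ := hup x h
          exact hnpp p' c hp' hc
  · obtain ⟨hD, -⟩ := h.of_diamondClass hx hC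
    exact hcrit ⟨⟨x, rfl⟩, hdisj, by rw [hD, hS], p, r, h.1, h.2.1, h.2.2.2.2⟩

theorem passesCompoundTest_iff (hS : starSet (powerGraph G) = {1}) {x : G}
    (hx : x ∉ starSet (powerGraph G)) :
    PassesCompoundTest (powerGraph G) (twinClass (powerGraph G) x) ↔
      ∃ y ∈ twinClass (powerGraph G) x, zpowers y ≠ zpowers x := by
  constructor
  · intro h
    by_contra hno
    push Not at hno
    exact not_passesCompoundTest_of_diamondClass hS hx (twinClass_eq_diamondClass hno) h
  · rintro ⟨y, hy, hne⟩
    exact passesCompoundTest_of_zpowers_ne hx hy hne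

theorem isPlain_twinClass_iff {x : G} :
    IsPlain (twinClass (powerGraph G) x) ↔
      ∀ y ∈ twinClass (powerGraph G) x, zpowers y = zpowers x := by
  refine ⟨?_, fun h => ⟨x, twinClass_eq_diamondClass h⟩⟩
  rintro ⟨z, hz⟩ y hy
  have hx : x ∈ twinClass (powerGraph G) x := mem_twinClass_self x
  rw [hz] at hx hy
  exact Eq.trans hy hx.symm

theorem isCompound_twinClass_iff {x : G} :
    IsCompound (twinClass (powerGraph G) x) ↔
      ∃ y ∈ twinClass (powerGraph G) x, zpowers y ≠ zpowers x := by
  constructor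
  · rintro ⟨𝒟, ⟨A, hA, B, hB, hAB⟩, h𝒟, hC⟩
    obtain ⟨a, rfl⟩ := h𝒟 A hA
    obtain ⟨b, rfl⟩ := h𝒟 B hB
    by_contra! hno
    have ha := hno a (hC ▸ ⟨_, hA, mem_diamondClass_self a⟩)
    have hb := hno b (hC ▸ ⟨_, hB, mem_diamondClass_self b⟩)
    exact hAB (by simp only [diamondClass, ha, hb])
  · rintro ⟨y, hy, hne⟩
    refine ⟨{D | ∃ z ∈ twinClass (powerGraph G) x, D = diamondClass z},
      ⟨_, ⟨y, hy, rfl⟩, _, ⟨x, rfl, rfl⟩, fun h => hne (h ▸ mem_diamondClass_self y :)⟩,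
      fun D ⟨z, _, hz⟩ => ⟨z, hz⟩, ?_⟩
    ext z
    constructor
    · exact fun hz => ⟨_, ⟨z, hz, rfl⟩, mem_diamondClass_self z⟩
    · rintro ⟨_, ⟨w, hw, rfl⟩, hz⟩
      exact Eq.trans (diamondClass_subset_twinClass w hz) hw

theorem isSplitting_primePowerPart (hS : starSet (powerGraph G) = {1}) :
    IsSplitting (powerGraph G) primePowerPart := by
  intro C hC hpass p r s hpar
  obtain ⟨x, hx, rfl⟩ := isNonstarClass_iff.1 hC
  obtain ⟨y, hy, hne⟩ := (passesCompoundTest_iff hS hx).1 hpass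
  obtain ⟨p', r', s', t, b, hpar', ht, hbt, hb, hC'⟩ := exists_hasParameters_of_zpowers_ne hx hy hne
  obtain ⟨rfl, rfl, rfl⟩ := hpar.unique hpar'
  have hp := hpar.1
  refine ⟨fun i hi => ?_, fun i hi j hj hij => ?_, ?_⟩
  · rw [primePowerPart_twinClass_eq hp ht hb hC' hi, ncard_orderOf_eq]
    exact ht ▸ pow_dvd_pow p hi.2
  · rw [Function.onFun, primePowerPart_twinClass_eq hp ht hb hC' hi,
      primePowerPart_twinClass_eq hp ht hb hC' hj]
    exact Set.disjoint_left.2 fun z hz hz' =>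
      hij (Nat.pow_right_injective hp.two_le (hz.2.symm.trans hz'.2))
  · ext z
    simp only [Set.mem_iUnion, exists_prop]
    refine ⟨fun ⟨i, _, hz⟩ => hz.1, fun hz => ?_⟩
    have hz' := hz
    rw [hC'] at hz'
    obtain ⟨j, hjr, hj⟩ := (Nat.dvd_prime_pow hp).1 (ht ▸ orderOf_dvd_of_mem_zpowers hz'.1)
    refine ⟨j, ⟨?_, hjr⟩, hz, p, hp, hj⟩
    by_contra hjs
    refine hz'.2 (mem_zpowers_of_orderOf_dvd hz'.1 hbt ?_)
    rw [hj, hb]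
    exact pow_dvd_pow p (by omega)

end CompoundTest

/-! ### Independence of the reconstruction from the splitting -/

section Splitting

variable {V : Type u} {Γ : SimpleGraph V} {X Y : Set V → ℕ → Set V} {v x y : V} {p r s i : ℕ}

/-- The indices `i` such that a vertex lies in the `i`-th part of its twin class. -/
def splitIndex (Γ : SimpleGraph V) (X : Set V → ℕ → Set V) (v : V) : Set ℕ :=
  {i | v ∉ starSet Γ ∧ PassesCompoundTest Γ (twinClass Γ v) ∧
    ∃ p r s, HasParameters Γ (twinClass Γ v) p r s ∧ i ∈ Set.Icc (s + 1) r ∧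
      v ∈ X (twinClass Γ v) i}

/-- The set of vertices with the same twin class and the same indices as `v`. -/
def blockOf (Γ : SimpleGraph V) (X : Set V → ℕ → Set V) (v : V) : Set V :=
  {u | (twinClass Γ u, splitIndex Γ X u) = (twinClass Γ v, splitIndex Γ X v)}

theorem mem_blockOf_self (v : V) : v ∈ blockOf Γ X v := rfl

theorem blockOf_eq_of_mem (h : x ∈ blockOf Γ X v) : blockOf Γ X x = blockOf Γ X v := by
  have h' : (twinClass Γ x, splitIndex Γ X x) = (twinClass Γ v, splitIndex Γ X v) := h
  simp only [blockOf, h']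

theorem twinClass_eq_iff : twinClass Γ x = twinClass Γ v ↔ x ∈ twinClass Γ v :=
  ⟨fun h => h ▸ mem_twinClass_self x, twinClass_eq_of_mem⟩

theorem isNonstarClass_twinClass (hv : v ∉ starSet Γ) : IsNonstarClass Γ (twinClass Γ v) :=
  isNonstarClass_iff.2 ⟨v, hv, rfl⟩

theorem IsSplitting.splitIndex_eq (hX : IsSplitting Γ X) (hv : v ∉ starSet Γ)
    (hpass : PassesCompoundTest Γ (twinClass Γ v)) (hpar : HasParameters Γ (twinClass Γ v) p r s)
    (hi : i ∈ Set.Icc (s + 1) r) (hvi : v ∈ X (twinClass Γ v) i) : splitIndex Γ X v = {i} := by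
  ext j
  simp only [splitIndex, Set.mem_ofPred_eq, Set.mem_singleton_iff]
  constructor
  · rintro ⟨-, -, p', r', s', hpar', hj, hvj⟩
    obtain ⟨rfl, rfl, rfl⟩ := hpar.unique hpar'
    by_contra hji
    exact Set.disjoint_left.1
      ((hX _ (isNonstarClass_twinClass hv) hpass _ _ _ hpar).2.1 hj hi hji) hvj hvi
  · rintro rfl
    exact ⟨hv, hpass, p, r, s, hpar, hi, hvi⟩

theorem IsSplitting.exists_mem (hX : IsSplitting Γ X) (hv : v ∉ starSet Γ)
    (hpass : PassesCompoundTest Γ (twinClass Γ v)) (hpar : HasParameters Γ (twinClass Γ v) p r s) :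
    ∃ i ∈ Set.Icc (s + 1) r, v ∈ X (twinClass Γ v) i := by
  have h := (hX _ (isNonstarClass_twinClass hv) hpass _ _ _ hpar).2.2.ge (mem_twinClass_self v)
  simpa only [Set.mem_iUnion, exists_prop] using h

theorem IsSplitting.subset (hX : IsSplitting Γ X) (hv : v ∉ starSet Γ)
    (hpass : PassesCompoundTest Γ (twinClass Γ v)) (hpar : HasParameters Γ (twinClass Γ v) p r s)
    (hi : i ∈ Set.Icc (s + 1) r) : X (twinClass Γ v) i ⊆ twinClass Γ v := by
  intro u hu
  refine (hX _ (isNonstarClass_twinClass hv) hpass _ _ _ hpar).2.2.le ?_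
  simp only [Set.mem_iUnion, exists_prop]
  exact ⟨i, hi, hu⟩

theorem IsSplitting.setOf_eq (hX : IsSplitting Γ X) (hv : v ∉ starSet Γ)
    (hpass : PassesCompoundTest Γ (twinClass Γ v)) (hpar : HasParameters Γ (twinClass Γ v) p r s)
    (hi : i ∈ Set.Icc (s + 1) r) :
    {u | (twinClass Γ u, splitIndex Γ X u) = (twinClass Γ v, {i})} = X (twinClass Γ v) i := by
  ext u
  simp only [Set.mem_ofPred_eq, Prod.mk.injEq]
  constructor
  · rintro ⟨hu, hui⟩
    obtain ⟨-, -, -, -, -, -, -, h⟩ : i ∈ splitIndex Γ X u := hui ▸ rfl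
    rwa [hu] at h
  · intro hu
    have huv := hX.subset hv hpass hpar hi hu
    have huv' := twinClass_eq_of_mem huv
    refine ⟨huv', hX.splitIndex_eq (p := p) (r := r) (s := s) ?_ (huv'.symm ▸ hpass)
      (huv'.symm ▸ hpar) hi (huv'.symm ▸ hu)⟩
    rwa [mem_starSet_of_twin huv]

theorem IsSplitting.blockOf_eq (hX : IsSplitting Γ X) (hv : v ∉ starSet Γ)
    (hpass : PassesCompoundTest Γ (twinClass Γ v)) (hpar : HasParameters Γ (twinClass Γ v) p r s)
    (hi : i ∈ Set.Icc (s + 1) r) (hvi : v ∈ X (twinClass Γ v) i) :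
    blockOf Γ X v = X (twinClass Γ v) i := by
  rw [blockOf, hX.splitIndex_eq hv hpass hpar hi hvi, hX.setOf_eq hv hpass hpar hi]

theorem splitIndex_eq_empty (h : v ∈ starSet Γ ∨ ¬ PassesCompoundTest Γ (twinClass Γ v)) :
    splitIndex Γ X v = ∅ := by
  refine Set.eq_empty_of_forall_notMem fun i hi => ?_
  exact h.elim hi.1 fun h => h hi.2.1

theorem blockOf_eq_twinClass (h : ¬ PassesCompoundTest Γ (twinClass Γ v)) :
    blockOf Γ X v = twinClass Γ v := by
  ext u
  simp only [blockOf, Set.mem_ofPred_eq, Prod.mk.injEq, twinClass_eq_iff, and_iff_left_iff_imp]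
  intro hu
  rw [splitIndex_eq_empty (Or.inr h), splitIndex_eq_empty (Or.inr (twinClass_eq_of_mem hu ▸ h))]

/-- Blocks are the fibres of the labelling of nonstar vertices by twin class and index set. This
form makes a bijection that respects labels respect blocks. -/
theorem IsSplitting.mem_blocks_iff
    (hpar : ∀ C, IsNonstarClass Γ C → PassesCompoundTest Γ C →
      ∃ p r s, HasParameters Γ C p r s)
    (hX : IsSplitting Γ X) {B : Set V} :
    B ∈ blocks Γ X ↔ ∃ v, v ∉ starSet Γ ∧ B = blockOf Γ X v := by
  constructor
  · rintro (⟨hB, hpass⟩ | ⟨C, hC, hpass, p, r, s, h, i, hi, rfl⟩)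
    · obtain ⟨v, hv, rfl⟩ := isNonstarClass_iff.1 hB
      exact ⟨v, hv, (blockOf_eq_twinClass hpass).symm⟩
    -- No part is empty, because `φ(p ^ i) > 0`; hence every part is the block of some vertex.
    · have hne : (X C i).Nonempty := by
        refine Set.nonempty_of_ncard_ne_zero ?_
        rw [(hX C hC hpass p r s h).1 i hi]
        exact (Nat.totient_pos.2 (pow_pos h.1.pos i)).ne'
      obtain ⟨v, hv, rfl⟩ := isNonstarClass_iff.1 hC
      obtain ⟨u, hu⟩ := hne
      have huv := hX.subset hv hpass h hi hu
      have huv' := twinClass_eq_of_mem huv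
      have huS : u ∉ starSet Γ := by rwa [mem_starSet_of_twin huv]
      rw [← huv'] at hu hpass h ⊢
      exact ⟨u, huS, (hX.blockOf_eq huS hpass h hi hu).symm⟩
  · rintro ⟨v, hv, rfl⟩
    by_cases hpass : PassesCompoundTest Γ (twinClass Γ v)
    · obtain ⟨p, r, s, h⟩ := hpar _ (isNonstarClass_twinClass hv) hpass
      obtain ⟨i, hi, hvi⟩ := hX.exists_mem hv hpass h
      exact Or.inr ⟨_, isNonstarClass_twinClass hv, hpass, p, r, s, h, i, hi,
        hX.blockOf_eq hv hpass h hi hvi⟩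
    · rw [blockOf_eq_twinClass hpass]
      exact Or.inl ⟨isNonstarClass_twinClass hv, hpass⟩

theorem IsSplitting.reconstruction_adj
    (hpar : ∀ C, IsNonstarClass Γ C → PassesCompoundTest Γ C →
      ∃ p r s, HasParameters Γ C p r s)
    (hX : IsSplitting Γ X) :
    (reconstruction Γ X).Adj x y ↔ Γ.Adj x y ∧ (y ∈ starSet Γ ∨ (x ∉ starSet Γ ∧ y ∉ starSet Γ ∧
      (blockOf Γ X x = blockOf Γ X y ∨ (blockOf Γ X y).ncard < (blockOf Γ X x).ncard ∨
        (blockOf Γ X x ≠ blockOf Γ X y ∧ (blockOf Γ X x).ncard = (blockOf Γ X y).ncard ∧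
          (blockOf Γ X x).ncard ≠ 1 ∧ ∃ z, z ∉ starSet Γ ∧ (blockOf Γ X z).ncard = 1 ∧
            AreJoined Γ (blockOf Γ X z) (blockOf Γ X x))))) := by
  have hmem : ∀ {v u}, v ∉ starSet Γ → u ∈ blockOf Γ X v → u ∉ starSet Γ := fun hv hu => by
    rwa [mem_starSet_of_twin (twinClass_eq_iff.1 (Prod.ext_iff.1 hu).1)]
  refine and_congr_right fun _ => or_congr_right ?_
  simp only [hX.mem_blocks_iff hpar]
  constructor
  · rintro ⟨_, ⟨v, hv, rfl⟩, _, ⟨u, hu, rfl⟩, hx, hy, h⟩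
    refine ⟨hmem hv hx, hmem hu hy, ?_⟩
    rw [blockOf_eq_of_mem hx, blockOf_eq_of_mem hy]
    refine h.imp_right (Or.imp_right ?_)
    rintro ⟨h1, h2, h3, _, ⟨z, hz, rfl⟩, h4⟩
    exact ⟨h1, h2, h3, z, hz, h4⟩
  · rintro ⟨hx, hy, h⟩
    refine ⟨_, ⟨x, hx, rfl⟩, _, ⟨y, hy, rfl⟩, rfl, rfl, h.imp_right (Or.imp_right ?_)⟩
    rintro ⟨h1, h2, h3, z, hz, h4⟩
    exact ⟨h1, h2, h3, _, ⟨z, hz, rfl⟩, h4⟩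

/-- A fibre meeting a compound-test class is a part of size `φ(p ^ i)` for either splitting;
elsewhere the index set is empty for both. An inequality suffices, since the roles of the splittings
can be exchanged. -/
theorem IsSplitting.ncard_fiber_le [Finite V]
    (hpar : ∀ C, IsNonstarClass Γ C → PassesCompoundTest Γ C →
      ∃ p r s, HasParameters Γ C p r s)
    (hX : IsSplitting Γ X) (hY : IsSplitting Γ Y)
    (k : Set V × Set ℕ) :
    {v | (twinClass Γ v, splitIndex Γ X v) = k}.ncard ≤
      {v | (twinClass Γ v, splitIndex Γ Y v) = k}.ncard := by
  by_cases h : ∃ v, v ∉ starSet Γ ∧ PassesCompoundTest Γ (twinClass Γ v) ∧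
      (twinClass Γ v, splitIndex Γ X v) = k
  · obtain ⟨v, hv, hpass, rfl⟩ := h
    have hC := isNonstarClass_twinClass hv
    obtain ⟨p, r, s, h⟩ := hpar _ hC hpass
    obtain ⟨i, hi, hvi⟩ := hX.exists_mem hv hpass h
    rw [hX.splitIndex_eq hv hpass h hi hvi, hX.setOf_eq hv hpass h hi, hY.setOf_eq hv hpass h hi,
      (hX _ hC hpass p r s h).1 i hi, (hY _ hC hpass p r s h).1 i hi]
  · refine Set.ncard_le_ncard (fun v hv => ?_) (Set.toFinite _)
    have h1 : v ∈ starSet Γ ∨ ¬ PassesCompoundTest Γ (twinClass Γ v) := by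
      by_contra! h2
      exact h ⟨v, h2.1, h2.2, hv⟩
    rw [Set.mem_ofPred_eq, splitIndex_eq_empty h1] at hv ⊢
    exact hv

/-- Any two splittings give isomorphic reconstructions. -/
theorem IsSplitting.nonempty_reconstruction_iso [Finite V]
    (hpar : ∀ C, IsNonstarClass Γ C → PassesCompoundTest Γ C →
      ∃ p r s, HasParameters Γ C p r s)
    (hX : IsSplitting Γ X)
    (hY : IsSplitting Γ Y) :
    Nonempty ((reconstruction Γ X).Adj ≃r (reconstruction Γ Y).Adj) := by
  have hcard : ∀ k, Nonempty ({v // (twinClass Γ v, splitIndex Γ X v) = k} ≃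
      {v // (twinClass Γ v, splitIndex Γ Y v) = k}) := fun k => by
    refine Finite.card_eq.1 ?_
    exact (hX.ncard_fiber_le hpar hY k).antisymm (hY.ncard_fiber_le hpar hX k)
  let σ : V ≃ V := Equiv.ofFiberEquiv fun k => (hcard k).some
  have hlabel : ∀ v, (twinClass Γ (σ v), splitIndex Γ Y (σ v)) =
      (twinClass Γ v, splitIndex Γ X v) := fun v => Equiv.ofFiberEquiv_map
    (f := fun v => (twinClass Γ v, splitIndex Γ X v))
    (g := fun v => (twinClass Γ v, splitIndex Γ Y v)) _ v
  have htwin : ∀ v, closedNbhd Γ (σ v) = closedNbhd Γ v := fun v =>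
    twinClass_eq_iff.1 (Prod.ext_iff.1 (hlabel v)).1
  have hstar : ∀ v, σ v ∈ starSet Γ ↔ v ∈ starSet Γ := fun v => mem_starSet_of_twin (htwin v)
  -- A permutation preserving every twin class is an automorphism of the graph: each endpoint can be
  -- replaced by its twin in turn.
  have hadj : ∀ a b, Γ.Adj (σ a) (σ b) ↔ Γ.Adj a b := fun a b => by
    have h1 : ∀ {a b}, Γ.Adj a b ↔ a ≠ b ∧ b ∈ closedNbhd Γ a := fun {a b} => by
      simp only [closedNbhd, Set.mem_ofPred_eq]
      exact ⟨fun h => ⟨h.ne, Or.inl h⟩, fun h => h.2.resolve_right h.1.symm⟩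
    rw [h1, h1, σ.injective.ne_iff, htwin, mem_closedNbhd_comm, htwin, mem_closedNbhd_comm]
  have hblock : ∀ v, blockOf Γ Y (σ v) = σ '' blockOf Γ X v := fun v => by
    ext u
    obtain ⟨u, rfl⟩ := σ.surjective u
    rw [σ.injective.mem_set_image, blockOf, blockOf, Set.mem_ofPred_eq, Set.mem_ofPred_eq, hlabel,
      hlabel]
  have hjoin : ∀ A B : Set V, AreJoined Γ (σ '' A) (σ '' B) ↔ AreJoined Γ A B := fun A B => by
    simp only [AreJoined, Set.exists_mem_image, hadj]
  refine ⟨⟨σ, fun {a b} => ?_⟩⟩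
  rw [hY.reconstruction_adj hpar, hX.reconstruction_adj hpar,
    σ.surjective.exists (p := fun z => z ∉ starSet Γ ∧ (blockOf Γ Y z).ncard = 1 ∧
      AreJoined Γ (blockOf Γ Y z) (blockOf Γ Y (σ a)))]
  simp only [hstar, hadj, hblock, Set.ncard_image_of_injective _ σ.injective,
    (Set.image_injective.2 σ.injective).eq_iff, (Set.image_injective.2 σ.injective).ne_iff, hjoin]

end Splitting

/-! ### The reconstruction from the classes of generators -/

section PowerGraph

variable {G : Type u} [Group G] [Finite G]

open Subgroup

theorem exists_hasParameters (hS : starSet (powerGraph G) = {1}) (C : Set G)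
    (hC : IsNonstarClass (powerGraph G) C) (hpass : PassesCompoundTest (powerGraph G) C) :
    ∃ p r s, HasParameters (powerGraph G) C p r s := by
  obtain ⟨x, hx, rfl⟩ := isNonstarClass_iff.1 hC
  obtain ⟨y, hy, hne⟩ := (passesCompoundTest_iff hS hx).1 hpass
  obtain ⟨p, r, s, -, -, h, -⟩ := exists_hasParameters_of_zpowers_ne hx hy hne
  exact ⟨p, r, s, h⟩

theorem blockOf_primePowerPart (hS : starSet (powerGraph G) = {1}) {x : G}
    (hx : x ∉ starSet (powerGraph G)) :
    blockOf (powerGraph G) primePowerPart x = diamondClass x := by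
  by_cases hpass : PassesCompoundTest (powerGraph G) (twinClass (powerGraph G) x)
  · obtain ⟨y, hy, hne⟩ := (passesCompoundTest_iff hS hx).1 hpass
    obtain ⟨p, r, s, t, b, h, ht, hbt, hb, hC⟩ := exists_hasParameters_of_zpowers_ne hx hy hne
    have hX := isSplitting_primePowerPart hS
    obtain ⟨i, hi, hxi⟩ := hX.exists_mem hx hpass h
    rw [hX.blockOf_eq hx hpass h hi hxi]
    rw [primePowerPart_twinClass_eq h.1 ht hb hC hi] at hxi ⊢
    ext z
    refine ⟨fun hz => ?_, fun hz => ⟨?_, (orderOf_eq_of_zpowers_eq hz).trans hxi.2⟩⟩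
    · have := hz.2.trans hxi.2.symm
      exact zpowers_eq_iff.2 ⟨mem_zpowers_of_orderOf_dvd hz.1 hxi.1 this.dvd,
        mem_zpowers_of_orderOf_dvd hxi.1 hz.1 this.symm.dvd⟩
    · exact zpowers_le.2 hxi.1 (zpowers_eq_iff.1 hz).1
  · rw [blockOf_eq_twinClass hpass]
    rw [passesCompoundTest_iff hS hx] at hpass
    push Not at hpass
    exact twinClass_eq_diamondClass hpass

/-- Equal totients of `d ∣ m` with `d ≠ m` force `m = 2 d`, and `d` is odd because `φ(2 d) = 2 φ(d)`
for even `d`. This is the only tie that block sizes leave undecided. -/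
theorem totient_lt_or_of_dvd {d m : ℕ} (hdm : d ∣ m) (hd : 1 < d) (hm : 0 < m) (hne : d ≠ m) :
    d.totient < m.totient ∨ d.totient = m.totient ∧ 2 < d ∧ Odd d ∧ 2 ∣ m := by
  rcases (Nat.le_of_dvd (Nat.totient_pos.2 hm) (Nat.totient_dvd_of_dvd hdm)).lt_or_eq with h | h
  · exact Or.inl h
  obtain rfl : 2 * d = m := (Nat.eq_or_eq_of_totient_eq_totient hdm h).resolve_left hne
  have hodd : Odd d := by
    rw [← Nat.not_even_iff_odd]
    intro he
    rw [Nat.totient_mul_of_prime_of_dvd Nat.prime_two he.two_dvd] at h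
    have := Nat.totient_pos.2 (hd.trans' one_pos)
    omega
  refine Or.inr ⟨h, ?_, hodd, dvd_mul_right 2 d⟩
  obtain ⟨k, rfl⟩ := hodd
  omega

theorem reconstruction_primePowerPart_adj (hS : starSet (powerGraph G) = {1}) (x y : G) :
    (reconstruction (powerGraph G) primePowerPart).Adj x y ↔ (directedPowerGraph G).Adj x y := by
  have hS' : ∀ {x : G}, x ∈ starSet (powerGraph G) ↔ x = 1 := fun {x} => by
    rw [hS, Set.mem_singleton_iff]
  rw [(isSplitting_primePowerPart hS).reconstruction_adj (exists_hasParameters hS),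
    directedPowerGraph_adj, powerGraph_adj, and_assoc]
  refine and_congr_right fun hxy => ?_
  by_cases hy : y = 1
  · subst hy
    simp [one_mem_starSet, one_mem]
  by_cases hx : x = 1
  · subst hx
    simp [hS', hy]
  have hbx := blockOf_primePowerPart hS (hS'.not.2 hx)
  have hby := blockOf_primePowerPart hS (hS'.not.2 hy)
  have hx1 : 1 < orderOf x := by
    have := orderOf_pos x; have := orderOf_eq_one_iff.not.2 hx; omega
  have hy1 : 1 < orderOf y := by
    have := orderOf_pos y; have := orderOf_eq_one_iff.not.2 hy; omega
  rw [hbx, hby]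
  simp only [ncard_diamondClass, hS', hx, hy, false_or, not_false_eq_true, true_and]
  constructor
  · rintro ⟨hcomp, h⟩
    by_contra hyx
    have hxy' := hcomp.resolve_right hyx
    have hne : zpowers x ≠ zpowers y := fun h => hyx (h ▸ mem_zpowers y)
    have hone : orderOf x ≠ orderOf y := fun h =>
      hne (zpowers_eq_of_mem_of_orderOf_le hxy' h.ge)
    have key := totient_lt_or_of_dvd (orderOf_dvd_of_mem_zpowers hxy') hx1 (orderOf_pos y) hone
    rcases h with h | h | ⟨-, h1, -, z, hz, hz1, a, ha, b, hb, hab⟩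
    · exact hne (show x ∈ diamondClass y from h ▸ mem_diamondClass_self x)
    · omega
    -- In a tie, `|x|` is odd and greater than `2`. A nonidentity block of size `1` consists of an
    -- involution, which cannot be comparable with an element of such an order.
    · obtain ⟨-, h2, hodd, -⟩ := key.resolve_left (by omega)
      rw [blockOf_primePowerPart hS (hS'.not.2 hz)] at hz1 ha
      rw [ncard_diamondClass, Nat.totient_eq_one_iff, orderOf_eq_one_iff, or_iff_right hz] at hz1
      have ha' := orderOf_eq_of_zpowers_eq ha
      have hb' := orderOf_eq_of_zpowers_eq hb
      rcases (powerGraph_adj.1 hab).2 with h3 | h3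
      · have := orderOf_dvd_of_mem_zpowers h3
        rw [ha', hz1, hb'] at this
        exact Nat.not_even_iff_odd.2 hodd (even_iff_two_dvd.2 this)
      · have := orderOf_dvd_of_mem_zpowers h3
        rw [ha', hz1, hb'] at this
        have := Nat.le_of_dvd two_pos this
        omega
  · intro hyx
    refine ⟨Or.inr hyx, ?_⟩
    by_cases hz : zpowers x = zpowers y
    · exact Or.inl (by simp only [diamondClass, hz])
    have hone : orderOf y ≠ orderOf x := fun h =>
      hz (zpowers_eq_of_mem_of_orderOf_le hyx h.ge).symm
    refine Or.inr ((totient_lt_or_of_dvd (orderOf_dvd_of_mem_zpowers hyx) hy1 (orderOf_pos x)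
      hone).imp_right ?_)
    rintro ⟨h1, h2, -, h4⟩
    -- In a tie `|x|` is even, and the involution in `⟨x⟩` supplies the block of size `1`.
    obtain ⟨z, hzx, hz2⟩ := exists_mem_zpowers_orderOf_eq x h4
    have hz1 : z ≠ 1 := by
      rintro rfl
      simp at hz2
    have hxz : z ≠ x := by
      rintro rfl
      have := Nat.le_of_dvd (by omega) (orderOf_dvd_of_mem_zpowers hyx)
      omega
    have hbz := blockOf_primePowerPart hS (hS'.not.2 hz1)
    refine ⟨fun h => hz (show x ∈ diamondClass y from h ▸ mem_diamondClass_self x), h1.symm, ?_,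
      z, hz1, ?_, z, mem_blockOf_self z, x, mem_diamondClass_self x,
      powerGraph_adj.2 ⟨hxz, Or.inl hzx⟩⟩
    · rw [← h1, ne_eq, Nat.totient_eq_one_iff]
      omega
    · rw [hbz, ncard_diamondClass, hz2, Nat.totient_two]

end PowerGraph

/-! ### Finite `p`-groups with a unique subgroup of order `p` -/

section PGroup

variable {G : Type u} [Group G]

open Subgroup

theorem exists_mul_add_dvd {n p c t : ℤ} (hc : IsCoprime c n) (ht : p ∣ t) :
    ∃ i : ℤ, n ∣ i * (p * c) + t := by
  obtain ⟨t, rfl⟩ := ht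
  obtain ⟨x, y, h⟩ := hc
  refine ⟨-t * x, p * t * y, ?_⟩
  linear_combination (-p * t) * h

/-- Fermat gives `r ≡ 1` modulo `p`, and lifting the exponent shows that the geometric sum is `p`
times a unit modulo `p ^ k`. Also `p ∣ t`, as otherwise the third hypothesis contradicts the second;
so the congruence can be solved for `i`. -/
theorem exists_dvd_mul_geom_sum_add {p k : ℕ} (hp : p.Prime) (hp2 : p ≠ 2) {r t : ℤ}
    (h1 : (p : ℤ) ^ k ∣ r ^ p - 1) (h2 : ¬ (p : ℤ) ^ k ∣ r - 1) (h3 : (p : ℤ) ^ k ∣ (r - 1) * t) :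
    ∃ i : ℤ, (p : ℤ) ^ k ∣ i * (∑ j ∈ Finset.range p, r ^ j) + t := by
  have hp' : Prime (p : ℤ) := Nat.prime_iff_prime_int.1 hp
  have hk : k ≠ 0 := by rintro rfl; simp at h2
  have hpr : (p : ℤ) ∣ r - 1 := by
    have := Fact.mk hp
    have h := (dvd_pow_self (p : ℤ) hk).trans h1
    rw [← ZMod.intCast_zmod_eq_zero_iff_dvd] at h ⊢
    push_cast at h ⊢
    rwa [ZMod.pow_card] at h
  have hpr' : ¬ (p : ℤ) ∣ r := fun h => hp'.not_dvd_one (by simpa using dvd_sub h hpr)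
  have hfin : FiniteMultiplicity (p : ℤ) (r - 1) := by
    refine Int.finiteMultiplicity_iff.2 ⟨by simpa using hp.ne_one, fun h => h2 (h ▸ dvd_zero _)⟩
  have hN : emultiplicity (p : ℤ) (∑ j ∈ Finset.range p, r ^ j) = 1 := by
    have h := Int.emultiplicity_pow_sub_pow hp (hp.odd_of_ne_two hp2) (x := r) (y := 1) hpr hpr' p
    rw [one_pow, ← geom_sum_mul, emultiplicity_mul hp', add_comm,
      (Nat.finiteMultiplicity_iff.2 ⟨hp.ne_one, hp.pos⟩ :
        FiniteMultiplicity p p).emultiplicity_self] at h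
    exact ENat.add_right_injective_of_ne_top (finiteMultiplicity_iff_emultiplicity_ne_top.1 hfin) h
  obtain ⟨c, hc⟩ : (p : ℤ) ∣ ∑ j ∈ Finset.range p, r ^ j := by
    rw [← pow_one (p : ℤ), pow_dvd_iff_le_emultiplicity, hN]; rfl
  have hcp : ¬ (p : ℤ) ∣ c := by
    intro h
    have : (p : ℤ) ^ 2 ∣ ∑ j ∈ Finset.range p, r ^ j := by
      rw [hc, pow_two]; exact mul_dvd_mul_left _ h
    rw [pow_dvd_iff_le_emultiplicity, hN] at this
    exact absurd this (by decide)
  have hcop : ∀ {d : ℤ}, ¬ (p : ℤ) ∣ d → IsCoprime d ((p : ℤ) ^ k) := fun h =>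
    ((hp'.coprime_iff_not_dvd.2 h).symm).pow_right
  have ht : (p : ℤ) ∣ t := by
    by_contra ht
    exact h2 ((hcop ht).symm.dvd_of_dvd_mul_right h3)
  rw [hc]
  exact exists_mul_add_dvd (hcop hcp) ht

/-- If `r ≡ 1` modulo `4`, then `1 + r` is twice an odd number and the congruence is solvable as for
odd primes. Hence `r - 1` is twice an odd number, and `2 ^ (k - 1)` divides both `t` and `r + 1`.
Unsolvability at `i = 0` makes the cofactor of `t` odd, and at `i = 1` makes that of `r + 1` even.
-/
theorem two_pow_dvd_of_forall_not_dvd {k : ℕ} {r t : ℤ} (h1 : (2 : ℤ) ^ k ∣ r ^ 2 - 1)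
    (h2 : ¬ (2 : ℤ) ^ k ∣ r - 1) (h3 : (2 : ℤ) ^ k ∣ (r - 1) * t)
    (h4 : ∀ i : ℤ, ¬ (2 : ℤ) ^ k ∣ i * (1 + r) + t) :
    2 ≤ k ∧ (2 : ℤ) ^ k ∣ r + 1 ∧ (2 : ℤ) ^ k ∣ t - 2 ^ (k - 1) := by
  have hp' : Prime (2 : ℤ) := Int.prime_two
  obtain ⟨k, rfl⟩ : ∃ l, k = l + 1 := Nat.exists_eq_succ_of_ne_zero (by rintro rfl; simp at h2)
  have hcop : ∀ {d : ℤ}, ¬ (2 : ℤ) ∣ d → IsCoprime d ((2 : ℤ) ^ (k + 1)) := fun h =>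
    ((hp'.coprime_iff_not_dvd.2 h).symm).pow_right
  have hr : ¬ (2 : ℤ) ∣ r := fun h => by
    have h5 := dvd_sub (dvd_pow h two_ne_zero) ((dvd_pow_self 2 k.succ_ne_zero).trans h1)
    rw [sub_sub_cancel] at h5
    exact hp'.not_dvd_one h5
  have hk : k ≠ 0 := by
    rintro rfl
    exact h2 (by rw [zero_add, pow_one]; omega)
  rcases (by omega : r % 4 = 1 ∨ r % 4 = 3) with h4r | h4r
  · exfalso
    have ht : (2 : ℤ) ∣ t := by
      by_contra ht
      exact h2 ((hcop ht).symm.dvd_of_dvd_mul_right h3)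
    obtain ⟨c, hc⟩ : (2 : ℤ) ∣ 1 + r := by omega
    obtain ⟨i, hi⟩ := exists_mul_add_dvd (hcop (d := c) (by omega)) ht
    exact h4 i (hc ▸ hi)
  obtain ⟨d, hd⟩ : (2 : ℤ) ∣ r - 1 := by omega
  have hd2 : ¬ (2 : ℤ) ∣ d := by omega
  have key : ∀ {w : ℤ}, (2 : ℤ) ^ (k + 1) ∣ (r - 1) * w → (2 : ℤ) ^ k ∣ w := fun {w} h => by
    rw [hd, mul_comm 2 d, mul_assoc] at h
    have := (hcop hd2).symm.dvd_of_dvd_mul_left h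
    rw [pow_succ, mul_comm] at this
    exact (mul_dvd_mul_iff_left two_ne_zero).1 this
  obtain ⟨t', rfl⟩ := key h3
  obtain ⟨r', hr'⟩ := key (w := r + 1) (by convert h1 using 1; ring)
  have hdvd : ∀ {w : ℤ}, (2 : ℤ) ^ (k + 1) ∣ 2 ^ k * w ↔ 2 ∣ w := fun {w} => by
    rw [pow_succ, mul_dvd_mul_iff_left (by positivity)]
  have ht' : ¬ 2 ∣ t' := fun h => h4 0 (by rw [zero_mul, zero_add, hdvd]; exact h)
  have hr2 : 2 ∣ r' := by
    by_contra hr2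
    refine h4 1 ?_
    rw [one_mul, add_comm 1 r, hr', ← mul_add, hdvd]
    omega
  refine ⟨by omega, by rwa [hr', hdvd], ?_⟩
  rw [Nat.add_sub_cancel, ← mul_sub_one, hdvd]
  omega

theorem conj_pow_zpow {a g : G} {r : ℤ} (h : g * a * g⁻¹ = a ^ r) (m : ℕ) (i : ℤ) :
    g ^ m * a ^ i = a ^ (r ^ m * i) * g ^ m := by
  induction m generalizing i with
  | zero => simp
  | succ m ih =>
    have h1 : g * a ^ i = a ^ (r * i) * g := by
      rw [zpow_mul, ← h, conj_zpow, inv_mul_cancel_right]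
    rw [pow_succ, mul_assoc, h1, ← mul_assoc, ih, mul_assoc, ← mul_assoc (r ^ m), pow_succ r]

theorem zpow_mul_pow {a g : G} {r : ℤ} (h : g * a * g⁻¹ = a ^ r) (m : ℕ) (i : ℤ) :
    (a ^ i * g) ^ m = a ^ (i * ∑ j ∈ Finset.range m, r ^ j) * g ^ m := by
  induction m with
  | zero => simp
  | succ m ih =>
    rw [pow_succ, ih, Finset.sum_range_succ, mul_add, zpow_add, mul_assoc, ← mul_assoc (g ^ m),
      conj_pow_zpow h, mul_comm i (r ^ m), pow_succ g]
    simp only [mul_assoc]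

/-- An element normalizing but not centralizing a cyclic `p`-subgroup that contains its `p`-th
power, in the situation where all elements of order `p` lie in that cyclic subgroup. -/
theorem pow_dvd_of_pow_mem_zpowers {p k : ℕ} {a g : G} {r t : ℤ} (ha : orderOf a = p ^ k)
    (hord : ∀ x : G, x ^ p = 1 → x ∈ zpowers a) (hg : g ∉ zpowers a)
    (hcent : ∀ x : G, x * a = a * x → x ∈ zpowers a)
    (hr : g * a * g⁻¹ = a ^ r) (ht : g ^ p = a ^ t) :
    (p : ℤ) ^ k ∣ r ^ p - 1 ∧ ¬ (p : ℤ) ^ k ∣ r - 1 ∧ (p : ℤ) ^ k ∣ (r - 1) * t ∧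
      ∀ i : ℤ, ¬ (p : ℤ) ^ k ∣ i * (∑ j ∈ Finset.range p, r ^ j) + t := by
  have hdvd : ∀ z : ℤ, (p : ℤ) ^ k ∣ z ↔ a ^ z = 1 := fun z => by
    rw [← orderOf_dvd_iff_zpow_eq_one, ha, Nat.cast_pow]
  simp only [hdvd]
  -- In turn: `g ^ p` lies in `⟨a⟩` and so commutes with `a`; `g` does not centralize `a`; `g`
  -- commutes with `g ^ p`; and `(a ^ i * g) ^ p = 1` would put `g` into `⟨a⟩`.
  refine ⟨?_, fun h => hg (hcent g ?_), ?_, fun i hi => hg ?_⟩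
  · have h := conj_pow_zpow hr p 1
    rw [ht, ← zpow_add, add_comm, zpow_add] at h
    have := mul_right_cancel h
    rw [zpow_sub, ← mul_one (r ^ p), ← this, zpow_one, mul_inv_cancel]
  · rw [zpow_sub, mul_inv_eq_one, zpow_one] at h
    rw [h] at hr
    exact mul_inv_eq_iff_eq_mul.1 hr
  · have h := conj_pow_zpow hr 1 t
    rw [pow_one, pow_one, ← ht, ← pow_succ', pow_succ] at h
    have := mul_right_cancel h
    rw [sub_mul, one_mul, zpow_sub, ← ht, this, mul_inv_cancel]
  · have h1 := hord (a ^ i * g) (by rw [zpow_mul_pow hr, ht, ← zpow_add, hi])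
    exact (Subgroup.mul_mem_cancel_left _ (zpow_mem (mem_zpowers a) i)).1 h1

theorem mem_of_forall_pow_mem {p : ℕ} (hG : IsPGroup p G) {A : Subgroup G}
    (h : ∀ g : G, g ^ p ∈ A → g ∈ A) (g : G) : g ∈ A := by
  obtain ⟨m, hm⟩ := (isPGroup_iff_pow_pow_eq_one).1 hG g
  have : ∀ m : ℕ, g ^ p ^ m ∈ A → g ∈ A := fun m => by
    induction m with
    | zero => intro h1; simpa using h1
    | succ m ih => exact fun h1 => ih (h _ (by rwa [← pow_mul, ← pow_succ]))
  exact this m (hm ▸ one_mem A)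

variable [Finite G]

/-- A finite `p`-group has a normal subgroup that is its own centralizer. -/
theorem exists_normal_centralizer_eq_self {p : ℕ} (hp : p.Prime) (hG : IsPGroup p G) :
    ∃ A : Subgroup G, A.Normal ∧ centralizer (A : Set G) = A := by
  have := Fact.mk hp
  -- Take a maximal normal abelian `A`. If its centralizer `C` were larger, `C / A` would be a
  -- nontrivial normal subgroup of the `p`-group `G / A` and contain a nontrivial central element; a
  -- lift `c` makes `A⟨c⟩` a larger normal abelian subgroup.
  obtain ⟨A, ⟨hA, hAc⟩, hmax⟩ := Set.Finite.exists_maximal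
    (Set.toFinite {A : Subgroup G | A.Normal ∧ A ≤ centralizer (A : Set G)})
    ⟨⊥, inferInstance, bot_le⟩
  refine ⟨A, hA, ?_⟩
  by_contra hne
  set C := centralizer (A : Set G) with hC
  set M := C.map (QuotientGroup.mk' A) with hM
  have hCn : C.Normal := Subgroup.normal_centralizer
  have hMn : M.Normal := hCn.map _ (QuotientGroup.mk'_surjective A)
  have hMnt : Nontrivial M := by
    rw [Subgroup.nontrivial_iff_ne_bot]
    intro h
    rw [hM, Subgroup.map_eq_bot_iff, QuotientGroup.ker_mk'] at h
    exact hne (le_antisymm h hAc)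
  have hQ : IsPGroup p (G ⧸ A) := hG.to_quotient A
  have hpM : p ∣ Nat.card M := by
    obtain ⟨n, hn0, hn⟩ := (hQ.to_subgroup M).nontrivial_iff_card.1 hMnt
    exact hn ▸ dvd_pow_self p hn0.ne'
  obtain ⟨⟨m, hm⟩, hfix, hm1⟩ :=
    (hQ.of_equiv ConjAct.toConjAct).exists_fixed_point_of_prime_dvd_card_of_fixed_point M hpM (a := 1) (fun g => smul_one g)
  obtain ⟨c, hc, rfl⟩ := hm
  have hcA : c ∉ A := fun h => hm1 (Subtype.ext ((QuotientGroup.eq_one_iff c).2 h).symm)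
  have hconj : ∀ g : G, c⁻¹ * (g * c * g⁻¹) ∈ A := fun g => by
    have h := congrArg Subtype.val (hfix (ConjAct.toConjAct (g : G ⧸ A)))
    exact QuotientGroup.eq.1 h.symm
  have hB : A ⊔ zpowers c ∈ {A : Subgroup G | A.Normal ∧ A ≤ centralizer (A : Set G)} := by
    refine ⟨⟨fun b hb g => ?_⟩, ?_⟩
    · have h : A ⊔ zpowers c ≤ (A ⊔ zpowers c).comap (MulAut.conj g).toMonoidHom := by
        refine sup_le (fun x hx => ?_) (zpowers_le.2 ?_)
        · exact le_sup_left (a := A) (hA.conj_mem x hx g)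
        · change g * c * g⁻¹ ∈ A ⊔ zpowers c
          rw [← mul_inv_cancel_left c (g * c * g⁻¹)]
          exact mul_mem (le_sup_right (a := A) (mem_zpowers c)) (le_sup_left (a := A) (hconj g))
      exact h hb
    · have h1 : zpowers c ≤ centralizer (A : Set G) := zpowers_le.2 hc
      have h2 : zpowers c ≤ centralizer (zpowers c : Set G) :=
        Subgroup.le_centralizer (zpowers c)
      refine sup_le ?_ ?_
      · exact le_centralizer_iff.1 (sup_le hAc h1)
      · exact le_centralizer_iff.1 (sup_le (le_centralizer_iff.1 h1) h2)
  exact hcA (hmax hB le_sup_left (le_sup_right (a := A) (mem_zpowers c)))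

/-- A commutative subgroup of a finite `p`-group with at most one subgroup of order `p` is
cyclic. -/
theorem exists_eq_zpowers_of_le_centralizer {p : ℕ} (hp : p.Prime) (hG : IsPGroup p G)
    (huniq : ∀ x y : G, orderOf x = p → orderOf y = p → y ∈ zpowers x) {A : Subgroup G}
    (hA : A ≤ centralizer (A : Set G)) : ∃ a, A = zpowers a := by
  have := Fact.mk hp
  obtain ⟨t, htA, ht⟩ := Set.exists_max_image (A : Set G) orderOf (Set.toFinite _) ⟨1, one_mem A⟩
  refine ⟨t, le_antisymm (fun x hx => ?_) (zpowers_le.2 htA)⟩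
  by_cases ht1 : t = 1
  · have := ht x hx
    rw [ht1, orderOf_one] at this
    have := orderOf_pos x
    rw [orderOf_eq_one_iff.1 (by omega : orderOf x = 1)]
    exact one_mem _
  have hord : ∀ y : G, y ^ p = 1 → y ∈ zpowers t := fun y hy => by
    by_cases hy1 : y = 1
    · exact hy1 ▸ one_mem _
    obtain ⟨u, hu, hup⟩ := exists_mem_zpowers_orderOf_eq t (hG.dvd_orderOf ht1)
    exact zpowers_le.2 hu (huniq u y hup (orderOf_eq_prime hy hy1))
  have hstep : ∀ y ∈ A, y ^ p ∈ zpowers t → y ∈ zpowers t := by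
    intro y hy h
    obtain ⟨i, hi⟩ := mem_powers_iff_mem_zpowers.2 h
    simp only at hi
    have hcomm : Commute y t := (hA htA y hy)
    by_cases hpi : p ∣ i
    · obtain ⟨j, rfl⟩ := hpi
      have h1 : (y * (t ^ j)⁻¹) ^ p = 1 := by
        rw [(hcomm.pow_right j).inv_right.mul_pow, inv_pow, ← pow_mul, mul_comm j p, hi,
          mul_inv_cancel]
      exact (Subgroup.mul_mem_cancel_right _ (inv_mem (pow_mem (mem_zpowers t) j))).1 (hord _ h1)
    -- Here `y ^ p` has the same order as `t`, so `y` has larger order than `t`, against the choice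
    -- of `t`.
    · by_contra hyt
      obtain ⟨k, hk⟩ := IsPGroup.iff_orderOf.1 hG t
      have h1 : orderOf (y ^ p) = orderOf t := by
        rw [← hi]
        refine Nat.Coprime.orderOf_pow ?_
        rw [hk]
        exact Nat.Coprime.pow_left k ((Nat.Prime.coprime_iff_not_dvd hp).2 hpi)
      have hy1 : y ≠ 1 := fun h => hyt (h ▸ one_mem _)
      rw [orderOf_pow, Nat.gcd_eq_right (hG.dvd_orderOf hy1)] at h1
      have h2 := ht y hy
      rw [← h1] at h2
      exact absurd h2 (not_le.2 (Nat.div_lt_self (orderOf_pos y) hp.one_lt))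
  obtain ⟨m, hm⟩ := (isPGroup_iff_pow_pow_eq_one).1 hG x
  have : ∀ m : ℕ, x ^ p ^ m ∈ zpowers t → x ∈ zpowers t := fun m => by
    induction m with
    | zero => intro h1; simpa using h1
    | succ m ih => exact fun h1 => ih (hstep _ (pow_mem hx _) (by rwa [← pow_mul, ← pow_succ]))
  exact this m (hm ▸ one_mem _)

/-- A finite `p`-group with at most one subgroup of order `p` is cyclic or has the structure of a
generalized quaternion group. -/
theorem isCyclic_or_exists_quaternion_structure {p : ℕ} (hp : p.Prime) (hG : IsPGroup p G)
    (huniq : ∀ x y : G, orderOf x = p → orderOf y = p → y ∈ zpowers x) :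
    IsCyclic G ∨ ∃ (a : G) (k : ℕ), 2 ≤ k ∧ orderOf a = 2 ^ k ∧ (∃ x, x ∉ zpowers a) ∧
      (∀ g, g ∉ zpowers a → g * a * g⁻¹ = a⁻¹ ∧ g ^ 2 = a ^ 2 ^ (k - 1)) ∧
      ∀ g h, g ∉ zpowers a → h ∉ zpowers a → g⁻¹ * h ∈ zpowers a := by
  have := Fact.mk hp
  obtain ⟨A, hAn, hAc⟩ := exists_normal_centralizer_eq_self hp hG
  obtain ⟨a, rfl⟩ := exists_eq_zpowers_of_le_centralizer hp hG huniq hAc.ge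
  by_cases htop : ∀ g, g ∈ zpowers a
  · exact Or.inl ⟨a, htop⟩
  right
  have hcent : ∀ x : G, x * a = a * x → x ∈ zpowers a := fun x hx => by
    rw [← hAc, mem_centralizer_iff]
    intro y hy
    obtain ⟨i, rfl⟩ := hy
    exact ((show Commute x a from hx).zpow_right i).symm
  have ha1 : a ≠ 1 := by
    rintro rfl
    exact htop fun g => hcent g (by simp)
  have hord : ∀ y : G, y ^ p = 1 → y ∈ zpowers a := fun y hy => by
    by_cases hy1 : y = 1
    · exact hy1 ▸ one_mem _
    obtain ⟨u, hu, hup⟩ := exists_mem_zpowers_orderOf_eq a (hG.dvd_orderOf ha1)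
    exact zpowers_le.2 hu (huniq u y hup (orderOf_eq_prime hy hy1))
  obtain ⟨k, hk⟩ := IsPGroup.iff_orderOf.1 hG a
  have hconj : ∀ g, ∃ r : ℤ, g * a * g⁻¹ = a ^ r := fun g => by
    obtain ⟨r, hr⟩ := hAn.conj_mem a (mem_zpowers a) g
    exact ⟨r, hr.symm⟩
  obtain rfl : p = 2 := by
    by_contra hp2
    refine htop (mem_of_forall_pow_mem hG fun g hgp => ?_)
    by_contra hg
    obtain ⟨r, hr⟩ := hconj g
    obtain ⟨t, ht⟩ := hgp
    obtain ⟨h1, h2, h3, h4⟩ := pow_dvd_of_pow_mem_zpowers hk hord hg hcent hr ht.symm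
    obtain ⟨i, hi⟩ := exists_dvd_mul_geom_sum_add hp hp2 h1 h2 h3
    exact h4 i hi
  have hdvd : ∀ z : ℤ, (2 : ℤ) ^ k ∣ z ↔ a ^ z = 1 := fun z => by
    rw [← orderOf_dvd_iff_zpow_eq_one, hk, Nat.cast_pow, Nat.cast_ofNat]
  have hinv : ∀ g, g ∉ zpowers a → g ^ 2 ∈ zpowers a →
      2 ≤ k ∧ g * a * g⁻¹ = a⁻¹ ∧ g ^ 2 = a ^ 2 ^ (k - 1) := by
    intro g hg hg2
    obtain ⟨r, hr⟩ := hconj g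
    obtain ⟨t, ht⟩ := hg2
    obtain ⟨h1, h2, h3, h4⟩ := pow_dvd_of_pow_mem_zpowers hk hord hg hcent hr ht.symm
    simp only [Nat.cast_ofNat, Finset.sum_range_succ, Finset.range_zero, Finset.sum_empty, pow_zero,
      pow_one, zero_add] at h1 h2 h3 h4
    obtain ⟨h5, h6, h7⟩ := two_pow_dvd_of_forall_not_dvd h1 h2 h3 h4
    rw [hdvd] at h6 h7
    refine ⟨h5, ?_, ?_⟩
    · rw [hr, ← mul_eq_one_iff_eq_inv, ← zpow_add_one, h6]
    · rw [zpow_sub, mul_inv_eq_one] at h7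
      rw [← ht]
      simp only
      rw [h7, ← zpow_natCast, Nat.cast_pow, Nat.cast_ofNat]
  -- If not, `g ^ 2` inverts `a`, so `g` acts by an exponent with `r ^ 2 ≡ -1` modulo `2 ^ k`, which
  -- is impossible modulo `4`.
  have hfour : ∀ g : G, (g ^ 2) ^ 2 ∈ zpowers a → g ^ 2 ∈ zpowers a := by
    intro g hg4
    by_contra hg2
    obtain ⟨h1, h2, -⟩ := hinv _ hg2 hg4
    obtain ⟨r, hr⟩ := hconj g
    have h3 := conj_pow_zpow hr 2 1
    rw [zpow_one, mul_one, ← mul_inv_eq_iff_eq_mul, h2, ← zpow_neg_one, ← mul_inv_eq_one, ← zpow_neg,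
      ← zpow_add, ← hdvd] at h3
    have h4 : (4 : ℤ) ∣ -1 + -r ^ 2 := (pow_dvd_pow (2 : ℤ) h1).trans h3
    have h5 : r ^ 2 % 4 = 0 ∨ r ^ 2 % 4 = 1 := (Int.even_or_odd r).imp
      (fun ⟨q, hq⟩ => Int.emod_eq_zero_of_dvd ⟨q * q, by rw [hq]; ring⟩)
      Int.sq_mod_four_eq_one_of_odd
    generalize r ^ 2 = s at h4 h5
    omega
  have hsq : ∀ g : G, g ^ 2 ∈ zpowers a := by
    intro g
    obtain ⟨m, hm⟩ := (isPGroup_iff_pow_pow_eq_one).1 hG g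
    have : ∀ m : ℕ, (g ^ 2 ^ m) ^ 2 ∈ zpowers a → g ^ 2 ∈ zpowers a := fun m => by
      induction m with
      | zero => intro h1; simpa using h1
      | succ m ih =>
        intro h1
        rw [pow_succ 2 m, pow_mul] at h1
        exact ih (hfour _ h1)
    exact this m (by rw [hm, one_pow]; exact one_mem _)
  push Not at htop
  obtain ⟨x, hx⟩ := htop
  refine ⟨a, k, (hinv x hx (hsq x)).1, hk, ⟨x, hx⟩, fun g hg => (hinv g hg (hsq g)).2,
    fun g h hg hh => hcent _ ?_⟩
  -- Both `g` and `h` invert `a`, so `g⁻¹ * h` centralizes it.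
  have h1 := (hinv g hg (hsq g)).2.1
  have h2 := (hinv h hh (hsq h)).2.1
  rw [mul_inv_eq_iff_eq_mul] at h1 h2
  rw [mul_assoc, h2, inv_mul_eq_iff_eq_mul, ← mul_assoc, ← mul_assoc, h1]
  simp [mul_assoc]

end PGroup

open Subgroup

/-! ### Recognition of generalized quaternion groups -/

section Quaternion

variable {G : Type u} [Group G]

theorem pow_val_add {n : ℕ} [NeZero n] {a : G} (ha : a ^ n = 1) (i j : ZMod n) :
    a ^ (i + j).val = a ^ i.val * a ^ j.val := by
  rw [ZMod.val_add, ← pow_add, ← pow_eq_pow_mod _ ha]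

theorem pow_val_sub {n : ℕ} [NeZero n] {a : G} (ha : a ^ n = 1) (i j : ZMod n) :
    a ^ (i - j).val = a ^ i.val * (a ^ j.val)⁻¹ := by
  rw [eq_mul_inv_iff_mul_eq, ← pow_val_add ha, sub_add_cancel]

/-- The homomorphism from a generalized quaternion group given by two elements satisfying the
defining relations. -/
def quaternionLift {n : ℕ} [NeZero n] (a x : G) (ha : a ^ (2 * n) = 1) (hx : x * a * x⁻¹ = a⁻¹)
    (hx2 : x ^ 2 = a ^ n) : QuaternionGroup n →* G :=
  have hxa : ∀ i : ℕ, a ^ i * x = x * (a ^ i)⁻¹ := fun i => by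
    have h : x * a ^ i * x⁻¹ = (a ^ i)⁻¹ := by rw [← conj_pow, hx, inv_pow]
    rw [← mul_inv_eq_iff_eq_mul.1 (by rw [← conj_inv, h, inv_inv] : x * (a ^ i)⁻¹ * x⁻¹ = a ^ i)]
  have hn : a ^ ((n : ZMod (2 * n))).val = a ^ n := by
    rw [ZMod.val_natCast, ← pow_eq_pow_mod _ ha]
  MonoidHom.mk' (fun
    | .a i => a ^ i.val
    | .xa i => x * a ^ i.val) <| by
    rintro (i | i) (j | j)
    · simp only [QuaternionGroup.a_mul_a, pow_val_add ha]
    · simp only [QuaternionGroup.a_mul_xa, pow_val_sub ha]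
      rw [← mul_assoc (a ^ i.val), hxa, mul_assoc,
        ((Commute.refl a).pow_pow i.val j.val).inv_left.eq]
    · simp only [QuaternionGroup.xa_mul_a, pow_val_add ha, mul_assoc]
    · simp only [QuaternionGroup.xa_mul_xa, pow_val_add ha, pow_val_sub ha, hn]
      rw [mul_assoc x, ← mul_assoc (a ^ i.val), hxa, ← hx2, pow_two, mul_assoc (x * x),
        ← ((Commute.refl a).pow_pow i.val j.val).inv_left.eq]
      simp only [mul_assoc]

/-- The lift is injective because `a` has order exactly `2 n` and `x ∉ ⟨a⟩`, and surjective because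
the group is `⟨a⟩ ∪ x⟨a⟩`. -/
theorem nonempty_mulEquiv_quaternionGroup {n : ℕ} [NeZero n] {a x : G} (ha : orderOf a = 2 * n)
    (hxa : x ∉ zpowers a) (hx : x * a * x⁻¹ = a⁻¹) (hx2 : x ^ 2 = a ^ n)
    (h : ∀ g, g ∉ zpowers a → x⁻¹ * g ∈ zpowers a) : Nonempty (G ≃* QuaternionGroup n) := by
  have ha' : a ^ (2 * n) = 1 := ha ▸ pow_orderOf_eq_one a
  have hval : ∀ y ∈ zpowers a, ∃ i : ZMod (2 * n), a ^ i.val = y := by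
    rintro y ⟨m, rfl⟩
    refine ⟨(m : ZMod (2 * n)), ?_⟩
    simp only
    rw [← zpow_natCast, ZMod.val_intCast, ← ha, zpow_mod_orderOf]
  have hinj : ∀ i j : ZMod (2 * n), a ^ i.val = a ^ j.val → i = j := fun i j hij =>
    ZMod.val_injective _ (pow_injOn_Iio_orderOf (by rw [ha]; exact ZMod.val_lt i)
      (by rw [ha]; exact ZMod.val_lt j) hij)
  refine ⟨(MulEquiv.ofBijective (quaternionLift a x ha' hx hx2) ⟨?_, ?_⟩).symm⟩
  · have hne : ∀ i j : ZMod (2 * n), a ^ i.val ≠ x * a ^ j.val := fun i j hij => by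
      refine hxa ((Subgroup.mul_mem_cancel_right _ (pow_mem (mem_zpowers a) j.val)).1 ?_)
      exact hij ▸ pow_mem (mem_zpowers a) _
    rintro (i | i) (j | j) hij
    · exact congrArg _ (hinj i j hij)
    · exact absurd hij (hne i j)
    · exact absurd hij.symm (hne j i)
    · exact congrArg _ (hinj i j (mul_left_cancel hij))
  · intro g
    by_cases hg : g ∈ zpowers a
    · obtain ⟨i, hi⟩ := hval g hg
      exact ⟨.a i, hi⟩
    · obtain ⟨i, hi⟩ := hval _ (h g hg)
      refine ⟨.xa i, ?_⟩
      change x * a ^ i.val = g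
      rw [hi, mul_inv_cancel_left]

end Quaternion

/-! ### Power graphs with more than one star vertex -/

section Star

variable {G : Type u} [Group G] [Finite G]

theorem starSet_eq_univ_of_card_eq_prime_pow [IsCyclic G] {p k : ℕ} (hp : p.Prime)
    (h : Nat.card G = p ^ k) : starSet (powerGraph G) = Set.univ := by
  obtain ⟨g, hg⟩ := IsCyclic.exists_generator (α := G)
  refine Set.eq_univ_of_forall fun x => mem_starSet_powerGraph.2 fun y => ?_
  exact mem_or_mem_of_orderOf_prime_pow hp ((orderOf_eq_card_of_forall_mem_zpowers hg).trans h)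
    (hg y) (hg x)

theorem ncard_starSet_of_isCyclic [IsCyclic G] (h : ¬ ∃ p k : ℕ, p.Prime ∧ Nat.card G = p ^ k) :
    (starSet (powerGraph G)).ncard = 1 + (Nat.card G).totient := by
  obtain ⟨g, hg⟩ := IsCyclic.exists_generator (α := G)
  have hog := orderOf_eq_card_of_forall_mem_zpowers hg
  have hS : starSet (powerGraph G) = {1} ∪ diamondClass g := by
    ext x
    constructor
    · intro hx
      by_contra hx1
      simp only [Set.mem_union, Set.mem_singleton_iff, not_or] at hx1
      -- A star vertex that is neither `1` nor a generator lies strictly between them and is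
      -- comparable with everything, forcing prime power order.
      obtain ⟨p, b, hp, hb⟩ := exists_orderOf_eq_prime_pow hx1.1 (hg x)
        (fun h => hx1.2 (zpowers_eq_iff.2 ⟨hg x, h⟩))
        fun w _ => mem_closedNbhd_powerGraph.2 (mem_starSet_powerGraph.1 hx w)
      exact h ⟨p, b, hp, hog ▸ hb⟩
    · rintro (rfl | hx)
      · exact one_mem_starSet
      · rw [mem_starSet_of_twin (closedNbhd_eq_of_zpowers_eq hx)]
        exact mem_starSet_powerGraph.2 fun y => Or.inl (hg y)
  rw [hS, Set.ncard_union_eq _ (Set.toFinite _) (Set.toFinite _), Set.ncard_singleton,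
    ncard_diamondClass, hog]
  rw [Set.disjoint_singleton_left]
  intro h1
  -- If `1` were a generator, the order would be `1 = 2 ^ 0`, which counts as a prime power.
  refine h ⟨2, 0, Nat.prime_two, ?_⟩
  rw [← hog, ← orderOf_eq_of_zpowers_eq h1, orderOf_one, pow_zero]

/-- In a `p`-group, every subgroup of order `p` is comparable with `⟨z⟩` and thus is the one inside
it. Otherwise all primes dividing `|G|` divide `|z|`, so `z` is not a power of any element of prime
power order; hence `⟨z⟩` contains every subgroup of prime power order and is the whole group. -/
theorem isCyclic_or_of_mem_starSet {z : G} (hz : z ∈ starSet (powerGraph G)) (hz1 : z ≠ 1) :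
    IsCyclic G ∨ ∃ p : ℕ, p.Prime ∧ IsPGroup p G ∧
      ∀ x y : G, orderOf x = p → orderOf y = p → y ∈ zpowers x := by
  rw [mem_starSet_powerGraph] at hz
  by_cases hpp : ∃ p k : ℕ, p.Prime ∧ Nat.card G = p ^ k
  · obtain ⟨p, k, hp, hk⟩ := hpp
    have := Fact.mk hp
    have hG : IsPGroup p G := IsPGroup.of_card hk
    obtain ⟨u, hu, hup⟩ := exists_mem_zpowers_orderOf_eq z (hG.dvd_orderOf hz1)
    have hmem : ∀ x : G, orderOf x = p → zpowers x = zpowers u := fun x hx => by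
      rcases hz x with h | h
      · exact zpowers_eq_of_mem_of_orderOf_le (mem_zpowers_of_orderOf_dvd h hu (by rw [hx, hup]))
          (by rw [hx, hup])
      · exact (zpowers_eq_of_mem_of_orderOf_le (zpowers_le.2 h hu) (by rw [hx, hup])).symm
    refine Or.inr ⟨p, hp, hG, fun x y hx hy => ?_⟩
    rw [hmem x hx, ← hmem y hy]
    exact mem_zpowers y
  left
  have hprime : ∀ q : ℕ, q.Prime → q ∣ Nat.card G → q ∣ orderOf z := fun q hq hqG => by
    have := Fact.mk hq
    obtain ⟨x, hx⟩ := exists_prime_orderOf_dvd_card' q hqG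
    rcases hz x with h | h
    · exact hx ▸ orderOf_dvd_of_mem_zpowers h
    · have h1 := orderOf_dvd_of_mem_zpowers h
      rw [hx, Nat.dvd_prime hq, orderOf_eq_one_iff, or_iff_right hz1] at h1
      rw [h1]
  have hnpp : ∀ q b : ℕ, q.Prime → orderOf z ≠ q ^ b := fun q b hq h =>
    hpp ⟨q, _, hq, Nat.eq_prime_pow_of_unique_prime_dvd Nat.card_pos.ne' fun {r} hr hrG =>
      (Nat.prime_dvd_prime_iff_eq hr hq).1 (hr.dvd_of_dvd_pow (h ▸ hprime r hr hrG))⟩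
  have hcard : Nat.card G ∣ orderOf z := by
    refine (Nat.dvd_iff_prime_pow_dvd_dvd _ _).2 fun p k hp hpk => ?_
    have := Fact.mk hp
    obtain ⟨K, hK⟩ := Sylow.exists_subgroup_card_pow_prime p hpk
    rw [← hK, ← Nat.card_zpowers]
    refine Subgroup.card_dvd_of_le fun x hx => (hz x).resolve_right fun h => ?_
    have h1 : orderOf z ∣ p ^ k := (orderOf_dvd_of_mem_zpowers h).trans
      (hK ▸ Subgroup.orderOf_dvd_natCard K hx)
    obtain ⟨j, -, hj⟩ := (Nat.dvd_prime_pow hp).1 h1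
    exact hnpp p j hp hj
  exact isCyclic_of_orderOf_eq_card z ((orderOf_dvd_natCard z).antisymm hcard)

/-- Odd powers of `u` lie outside `A`, and even powers are powers of `z`. -/
theorem eq_one_or_eq_of_mem_zpowers {A : Subgroup G} {u z w : G} (hu : u ∉ A) (hu2 : u ^ 2 = z)
    (hz : z ∈ A) (hz2 : z ^ 2 = 1) (hw : w ∈ zpowers u) (hwA : w ∈ A) : w = 1 ∨ w = z := by
  obtain ⟨m, rfl⟩ := mem_powers_iff_mem_zpowers.2 hw
  simp only at hwA ⊢
  rcases Nat.even_or_odd' m with ⟨c, rfl | rfl⟩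
  · rw [pow_mul, hu2]
    rcases Nat.even_or_odd' c with ⟨d, rfl | rfl⟩
    · left; rw [pow_mul, hz2, one_pow]
    · right; rw [pow_succ, pow_mul, hz2, one_pow, one_mul]
  · rw [pow_succ, pow_mul, hu2] at hwA
    exact absurd ((Subgroup.mul_mem_cancel_left _ (pow_mem hz c)).1 hwA) hu

theorem starSet_eq_pair_of_quaternion_structure {a : G} {k : ℕ} (hk : 2 ≤ k)
    (ha : orderOf a = 2 ^ k) (hne : ∃ x, x ∉ zpowers a)
    (hsq : ∀ g, g ∉ zpowers a → g ^ 2 = a ^ 2 ^ (k - 1)) :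
    starSet (powerGraph G) = {1, a ^ 2 ^ (k - 1)} := by
  set z := a ^ 2 ^ (k - 1) with hz
  have hzA : z ∈ zpowers a := pow_mem (mem_zpowers a) _
  have hz2 : z ^ 2 = 1 := by
    rw [hz, ← pow_mul, ← pow_succ, Nat.sub_add_cancel (by omega), ← ha, pow_orderOf_eq_one]
  have ha2 : a ^ 2 ≠ 1 := fun h => by
    have h1 := orderOf_dvd_of_pow_eq_one h
    rw [ha, ← pow_one 2, ← pow_mul, Nat.pow_dvd_pow_iff_le_right one_lt_two] at h1
    omega
  ext s
  simp only [Set.mem_insert_iff, Set.mem_singleton_iff]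
  constructor
  · intro hs
    rw [mem_starSet_powerGraph] at hs
    by_cases hsA : s ∈ zpowers a
    · obtain ⟨x, hx⟩ := hne
      refine eq_one_or_eq_of_mem_zpowers hx (hsq x hx) hzA hz2 ?_ hsA
      exact (hs x).resolve_left fun h => hx (zpowers_le.2 hsA h)
    · exfalso
      have hsa : s * a ∉ zpowers a := fun h =>
        hsA ((Subgroup.mul_mem_cancel_right _ (mem_zpowers a)).1 h)
      have key : ∀ u, u ∉ zpowers a → a ∉ zpowers u := fun u hu h => by
        rcases eq_one_or_eq_of_mem_zpowers hu (hsq u hu) hzA hz2 h (mem_zpowers a) with h1 | h1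
        · exact ha2 (by rw [h1, one_pow])
        · exact ha2 (by rw [h1, hz2])
      -- If `s` and `s * a` are comparable, one of them has `a` as a power; but the cyclic group of
      -- an element outside `⟨a⟩` meets `⟨a⟩` only in `1` and `z`.
      rcases hs (s * a) with h | h
      · exact key s hsA ((Subgroup.mul_mem_cancel_left _ (mem_zpowers s)).1 h)
      · exact key _ hsa ((Subgroup.mul_mem_cancel_left _ h).1 (mem_zpowers (s * a)))
  · rintro (rfl | rfl)
    · exact one_mem_starSet
    · refine mem_starSet_powerGraph.2 fun y => ?_
      by_cases hy : y ∈ zpowers a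
      · exact mem_or_mem_of_orderOf_prime_pow Nat.prime_two ha hy hzA
      · exact Or.inr (hsq y hy ▸ pow_mem (mem_zpowers y) 2)

/-- The finite groups whose power graph has at most two vertices or more than one star vertex. -/
theorem starSet_trichotomy (h : Nat.card G ≤ 2 ∨ 1 < (starSet (powerGraph G)).ncard) :
    (IsCyclic G ∧ (∃ p k : ℕ, p.Prime ∧ Nat.card G = p ^ k) ∧
      (starSet (powerGraph G)).ncard = Nat.card G) ∨
    (IsCyclic G ∧ (¬ ∃ p k : ℕ, p.Prime ∧ Nat.card G = p ^ k) ∧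
      (starSet (powerGraph G)).ncard = 1 + (Nat.card G).totient) ∨
    ∃ k : ℕ, 1 ≤ k ∧ Nat.card G = 4 * 2 ^ k ∧ Nonempty (G ≃* QuaternionGroup (2 ^ k)) ∧
      (starSet (powerGraph G)).ncard = 2 := by
  have hcyc : IsCyclic G → ((IsCyclic G ∧ (∃ p k : ℕ, p.Prime ∧ Nat.card G = p ^ k) ∧
      (starSet (powerGraph G)).ncard = Nat.card G) ∨
    (IsCyclic G ∧ (¬ ∃ p k : ℕ, p.Prime ∧ Nat.card G = p ^ k) ∧
      (starSet (powerGraph G)).ncard = 1 + (Nat.card G).totient) ∨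
    ∃ k : ℕ, 1 ≤ k ∧ Nat.card G = 4 * 2 ^ k ∧ Nonempty (G ≃* QuaternionGroup (2 ^ k)) ∧
      (starSet (powerGraph G)).ncard = 2) := fun hG => by
    by_cases hpp : ∃ p k : ℕ, p.Prime ∧ Nat.card G = p ^ k
    · refine Or.inl ⟨hG, hpp, ?_⟩
      obtain ⟨p, k, hp, hk⟩ := hpp
      rw [starSet_eq_univ_of_card_eq_prime_pow hp hk, Set.ncard_univ]
    · exact Or.inr (Or.inl ⟨hG, hpp, ncard_starSet_of_isCyclic hpp⟩)
  rcases h with h | h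
  · refine hcyc (isCyclic_of_card_dvd_prime (p := 2) ?_)
    have := Nat.card_pos (α := G)
    interval_cases Nat.card G <;> decide
  obtain ⟨z, hz, hz1⟩ := Set.exists_ne_of_one_lt_ncard h 1
  rcases isCyclic_or_of_mem_starSet hz hz1 with hG | ⟨p, hp, hG, huniq⟩
  · exact hcyc hG
  rcases isCyclic_or_exists_quaternion_structure hp hG huniq with
    hG | ⟨a, k, hk, ha, ⟨x, hx⟩, h1, h2⟩
  · exact hcyc hG
  obtain ⟨k, rfl⟩ : ∃ l, k = l + 1 := ⟨k - 1, by omega⟩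
  have hne : NeZero (2 ^ k) := ⟨by positivity⟩
  obtain ⟨f⟩ := nonempty_mulEquiv_quaternionGroup (n := 2 ^ k) (by rw [ha, pow_succ']) hx
    (h1 x hx).1 (h1 x hx).2 fun g hg => h2 x g hx hg
  refine Or.inr (Or.inr ⟨k, by omega, ?_, ⟨f⟩, ?_⟩)
  · rw [Nat.card_congr f.toEquiv, Nat.card_eq_fintype_card, QuaternionGroup.card]
  · rw [starSet_eq_pair_of_quaternion_structure hk ha ⟨x, hx⟩ fun g hg => (h1 g hg).2,
      Set.ncard_pair]
    intro h3
    have h4 := orderOf_dvd_of_pow_eq_one h3.symm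
    rw [ha, Nat.pow_dvd_pow_iff_le_right one_lt_two] at h4
    omega

end Star

/-! ### Transport along isomorphisms -/

section Transport

variable {G : Type w} [Group G] {H : Type u} [Group H]

/-- An isomorphism of groups is an isomorphism of power graphs. -/
def powerGraphIso (f : G ≃* H) : powerGraph G ≃g powerGraph H where
  toEquiv := f.toEquiv
  map_rel_iff' {a b} := by
    simp only [powerGraph, MulEquiv.toEquiv_eq_coe, MulEquiv.coe_toEquiv, ← map_pow,
      f.injective.eq_iff, f.injective.ne_iff]

/-- An isomorphism of groups is an isomorphism of directed power graphs. -/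
def directedPowerGraphIso (f : G ≃* H) :
    (directedPowerGraph G).Adj ≃r (directedPowerGraph H).Adj where
  toEquiv := f.toEquiv
  map_rel_iff' {a b} := by
    simp only [directedPowerGraph, MulEquiv.toEquiv_eq_coe, MulEquiv.coe_toEquiv, ← map_pow,
      f.injective.eq_iff, f.injective.ne_iff]

theorem preimage_diamondClass (f : G ≃* H) (x : H) :
    f ⁻¹' diamondClass x = diamondClass (f.symm x) := by
  ext y
  have h1 : zpowers (f y) = (zpowers y).map f.toMonoidHom := (f.toMonoidHom.map_zpowers y).symm
  have h2 : zpowers x = (zpowers (f.symm x)).map f.toMonoidHom := by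
    rw [f.toMonoidHom.map_zpowers]
    simp
  rw [Set.mem_preimage, diamondClass, diamondClass, Set.mem_ofPred_eq, Set.mem_ofPred_eq, h1, h2]
  exact (Subgroup.map_injective (f := f.toMonoidHom) f.injective).eq_iff

theorem IsPlain.preimage (f : G ≃* H) {C : Set H} (h : IsPlain C) : IsPlain (f ⁻¹' C) := by
  obtain ⟨x, rfl⟩ := h
  exact ⟨f.symm x, preimage_diamondClass f x⟩

theorem IsCompound.preimage (f : G ≃* H) {C : Set H} (h : IsCompound C) :
    IsCompound (f ⁻¹' C) := by
  obtain ⟨𝒟, hnt, h𝒟, rfl⟩ := h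
  refine ⟨Set.image (Set.preimage f) 𝒟, hnt.image f.surjective.preimage_injective, ?_, ?_⟩
  · rintro _ ⟨D, hD, rfl⟩
    obtain ⟨x, rfl⟩ := h𝒟 D hD
    exact ⟨f.symm x, preimage_diamondClass f x⟩
  · rw [Set.preimage_sUnion, Set.sUnion_image]

theorem isPlain_preimage_iff (f : G ≃* H) {C : Set H} : IsPlain (f ⁻¹' C) ↔ IsPlain C := by
  refine ⟨fun h => ?_, IsPlain.preimage f⟩
  have := h.preimage f.symm
  rwa [← Set.preimage_comp, show (f ∘ f.symm : H → H) = id from funext f.apply_symm_apply] at this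

theorem isCompound_preimage_iff (f : G ≃* H) {C : Set H} :
    IsCompound (f ⁻¹' C) ↔ IsCompound C := by
  refine ⟨fun h => ?_, IsCompound.preimage f⟩
  have := h.preimage f.symm
  rwa [← Set.preimage_comp, show (f ∘ f.symm : H → H) = id from funext f.apply_symm_apply] at this

/-- A group structure can be moved along an isomorphism from its power graph to another graph. -/
theorem exists_group_of_powerGraph_iso {V : Type u} {Γ : SimpleGraph V} (e : powerGraph G ≃g Γ) :
    ∃ (_ : Group V) (f : G ≃* V), (f : G → V) = e ∧ powerGraph V = Γ := by
  let _ : Group V := e.toEquiv.symm.group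
  let f : G ≃* V := (Equiv.mulEquiv e.toEquiv.symm).symm
  have hf : (f : G → V) = e := rfl
  refine ⟨inferInstance, f, hf, ?_⟩
  ext a b
  obtain ⟨a, rfl⟩ := f.surjective a
  obtain ⟨b, rfl⟩ := f.surjective b
  exact (powerGraphIso f).map_adj_iff.trans (e.map_adj_iff (v := a) (w := b)).symm

end Transport

/-! ### Consequences for all groups with a given power graph -/

theorem starSet_trichotomy_of_iso {V : Type u} [Finite V] {Γ : SimpleGraph V} {G : Type w} [Group G]
    (e : powerGraph G ≃g Γ) (h : Nat.card V ≤ 2 ∨ 1 < (starSet Γ).ncard) :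
    (IsCyclic G ∧ (∃ p k : ℕ, p.Prime ∧ Nat.card V = p ^ k) ∧
      (starSet Γ).ncard = Nat.card V) ∨
    (IsCyclic G ∧ (¬ ∃ p k : ℕ, p.Prime ∧ Nat.card V = p ^ k) ∧
      (starSet Γ).ncard = 1 + (Nat.card V).totient) ∨
    ∃ k : ℕ, 1 ≤ k ∧ Nat.card V = 4 * 2 ^ k ∧ Nonempty (G ≃* QuaternionGroup (2 ^ k)) ∧
      (starSet Γ).ncard = 2 := by
  obtain ⟨_, f, -, rfl⟩ := exists_group_of_powerGraph_iso e
  refine (starSet_trichotomy h).imp (And.imp_left f.isCyclic.2)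
    (Or.imp (And.imp_left f.isCyclic.2) ?_)
  rintro ⟨k, h1, h2, ⟨g⟩, h3⟩
  exact ⟨k, h1, h2, ⟨f.trans g⟩, h3⟩

theorem determinesGroup_zmod {V : Type u} [Finite V] [Group V] [IsCyclic V]
    (h : ∀ (G : Type w) [Group G], Nonempty (powerGraph G ≃g powerGraph V) → IsCyclic G) :
    DeterminesGroup.{u, w} (powerGraph V) (Multiplicative (ZMod (Nat.card V))) := by
  have hcard : Nat.card (Multiplicative (ZMod (Nat.card V))) = Nat.card V := by
    rw [Nat.card_congr Multiplicative.toAdd, Nat.card_zmod]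
  refine ⟨⟨powerGraphIso (mulEquivOfCyclicCardEq hcard)⟩, fun G _ ⟨e⟩ => ?_⟩
  have := h G ⟨e⟩
  exact ⟨mulEquivOfCyclicCardEq ((Nat.card_congr e.toEquiv).trans hcard.symm)⟩

theorem starSet_powerGraph_eq_singleton {G : Type u} [Group G] [Finite G]
    (h : (starSet (powerGraph G)).ncard = 1) : starSet (powerGraph G) = {1} := by
  obtain ⟨x, hx⟩ := Set.ncard_eq_one.1 h
  have h1 : (1 : G) ∈ starSet (powerGraph G) := one_mem_starSet
  rw [hx, Set.mem_singleton_iff] at h1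
  rw [hx, h1]

end PowerGraphReconstruction

/-! ### Assembly of cases (A) and (B) -/

open PowerGraphReconstruction
theorem mainTheorem1 {V : Type u} [Finite V] (Γ : SimpleGraph V)
    (hΓ : IsPowerGraph Γ) :
    ((Nat.card V ≤ 2 ∨ 1 < (starSet Γ).ncard) ∧
      ((starSet Γ).ncard = Nat.card V ∨
        (starSet Γ).ncard = 1 + Nat.totient (Nat.card V) ∨
        (starSet Γ).ncard = 2) ∧
      ((starSet Γ).ncard = Nat.card V →
        (∃ p k : ℕ, p.Prime ∧ Nat.card V = p ^ k) ∧
        DeterminesGroup.{u, w} Γ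
          (Multiplicative (ZMod (Nat.card V)))) ∧
      ((starSet Γ).ncard = 1 + Nat.totient (Nat.card V) →
        (starSet Γ).ncard ≠ Nat.card V →
        (¬ ∃ p k : ℕ, p.Prime ∧ Nat.card V = p ^ k) ∧
        DeterminesGroup.{u, w} Γ
          (Multiplicative (ZMod (Nat.card V)))) ∧
      ((starSet Γ).ncard = 2 → 2 < Nat.card V →
        ∃ k : ℕ, 1 ≤ k ∧ Nat.card V = 4 * 2 ^ k ∧
          DeterminesGroup.{u, w} Γ (QuaternionGroup (2 ^ k)))) ∨
    (2 < Nat.card V ∧ (starSet Γ).ncard = 1 ∧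
      (∀ (G : Type w) [Group G] (e : powerGraph G ≃g Γ) (C : Set V),
        IsNonstarClass Γ C →
          (IsCompound (e ⁻¹' C) ↔
            PassesCompoundTest Γ C) ∧
          (IsPlain (e ⁻¹' C) ↔
            ¬ PassesCompoundTest Γ C)) ∧
      (∃ X, IsSplitting Γ X) ∧
      ∀ X, IsSplitting Γ X →
        ∀ (G : Type w) [Group G], Nonempty (powerGraph G ≃g Γ) →
          Nonempty ((reconstruction Γ X).Adj ≃r
            (directedPowerGraph G).Adj)) := by
  obtain ⟨_, rfl⟩ := hΓ
  have hpos : 0 < Nat.card V := Nat.card_pos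
  -- The prescribed star counts can coincide. This and the next fact settle the overlaps: `1 + φ(n)
  -- = n` only for prime `n`, and `1 + φ(n) = 2` only for `n ≤ 2`.
  have hprime : 1 + (Nat.card V).totient = Nat.card V →
      ∃ p k : ℕ, p.Prime ∧ Nat.card V = p ^ k := fun h =>
    ⟨Nat.card V, 1, (Nat.totient_eq_iff_prime hpos).1 (by omega), (pow_one _).symm⟩
  have hone : (Nat.card V).totient = 1 → Nat.card V ≤ 2 := fun h => by
    have := Nat.totient_eq_one_iff.1 h
    omega
  by_cases hn : Nat.card V ≤ 2 ∨ 1 < (starSet (powerGraph V)).ncard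
  · have T : ∀ (G : Type w) [Group G], Nonempty (powerGraph G ≃g powerGraph V) → _ :=
      fun G _ ⟨e⟩ => starSet_trichotomy_of_iso e hn
    have T₀ := starSet_trichotomy hn
    refine Or.inl ⟨hn, ?_, fun h1 => ?_, fun h1 h2 => ?_, fun h1 h2 => ?_⟩
    · rcases T₀ with ⟨-, -, h⟩ | ⟨-, -, h⟩ | ⟨-, -, -, -, h⟩
      · exact Or.inl h
      · exact Or.inr (Or.inl h)
      · exact Or.inr (Or.inr h)
    · have hpp : ∃ p k : ℕ, p.Prime ∧ Nat.card V = p ^ k := by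
        by_contra hpp
        rcases T₀ with ⟨-, h, -⟩ | ⟨-, -, h⟩ | ⟨k, h3, h4, -, h⟩
        · exact hpp h
        · exact hpp (hprime (h ▸ h1))
        · have := Nat.one_le_two_pow (n := k)
          omega
      have hq : ∀ k : ℕ, Nat.card V = 4 * 2 ^ k → (starSet (powerGraph V)).ncard ≠ 2 := by
        intro k hk h
        have := Nat.one_le_two_pow (n := k)
        omega
      have : IsCyclic V := by
        rcases T₀ with ⟨h, -⟩ | ⟨h, -⟩ | ⟨k, -, h3, -, h⟩
        · exact h
        · exact h
        · exact absurd h (hq k h3)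
      refine ⟨hpp, determinesGroup_zmod fun G _ e => ?_⟩
      rcases T G e with ⟨h, -⟩ | ⟨h, -⟩ | ⟨k, -, h3, -, h⟩
      · exact h
      · exact h
      · exact absurd h (hq k h3)
    · have hq : ∀ k : ℕ, Nat.card V = 4 * 2 ^ k → (starSet (powerGraph V)).ncard ≠ 2 := by
        intro k hk h
        have := Nat.one_le_two_pow (n := k)
        have := hone (by omega)
        omega
      have hV : IsCyclic V ∧ ¬ ∃ p k : ℕ, p.Prime ∧ Nat.card V = p ^ k := by
        rcases T₀ with ⟨-, -, h⟩ | ⟨h, h3, -⟩ | ⟨k, -, h3, -, h⟩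
        · exact absurd h h2
        · exact ⟨h, h3⟩
        · exact absurd h (hq k h3)
      have := hV.1
      refine ⟨hV.2, determinesGroup_zmod fun G _ e => ?_⟩
      rcases T G e with ⟨h, -⟩ | ⟨h, -⟩ | ⟨k, -, h3, -, h⟩
      · exact h
      · exact h
      · exact absurd h (hq k h3)
    · rcases T₀ with ⟨-, -, h⟩ | ⟨-, -, h⟩ | ⟨k, hk, h3, ⟨f⟩, -⟩
      · omega
      · have := hone (by omega)
        omega
      refine ⟨k, hk, h3, ⟨powerGraphIso f.symm⟩, fun G _ e => ?_⟩
      rcases T G e with ⟨-, -, h⟩ | ⟨-, -, h⟩ | ⟨l, -, h4, h, -⟩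
      · omega
      · have := hone (by omega)
        omega
      · obtain rfl : k = l := Nat.pow_right_injective le_rfl (by simp only; omega)
        exact h
  · push Not at hn
    have hS1 : (starSet (powerGraph V)).ncard = 1 := by
      have : 0 < (starSet (powerGraph V)).ncard :=
        (Set.ncard_pos (Set.toFinite _)).2 ⟨1, one_mem_starSet⟩
      omega
    refine Or.inr ⟨hn.1, hS1, fun G _ e C hC => ?_,
      ⟨_, isSplitting_primePowerPart (starSet_powerGraph_eq_singleton hS1)⟩, fun X hX G _ ⟨e⟩ => ?_⟩
    · obtain ⟨_, f, hf, hΓ⟩ := exists_group_of_powerGraph_iso e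
      rw [← hf, isCompound_preimage_iff, isPlain_preimage_iff]
      rw [← hΓ] at hC hS1 ⊢
      obtain ⟨x, hx, rfl⟩ := isNonstarClass_iff.1 hC
      have hS := starSet_powerGraph_eq_singleton hS1
      rw [isCompound_twinClass_iff, isPlain_twinClass_iff, passesCompoundTest_iff hS hx]
      push Not
      exact ⟨Iff.rfl, Iff.rfl⟩
    · obtain ⟨_, f, -, hΓ⟩ := exists_group_of_powerGraph_iso e
      rw [← hΓ] at hX hS1 ⊢
      have hS := starSet_powerGraph_eq_singleton hS1
      -- The given splitting is compared with the one by element orders, whose reconstruction is the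
      -- directed power graph itself.
      obtain ⟨σ⟩ := hX.nonempty_reconstruction_iso (exists_hasParameters hS)
        (isSplitting_primePowerPart hS)
      exact ⟨(σ.trans ⟨Equiv.refl V, fun {a b} =>
        (reconstruction_primePowerPart_adj hS a b).symm⟩).trans (directedPowerGraphIso f).symm⟩
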